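/- **Setting.** Let $M$ be a complete connected Riemannian manifold, and let $\mu$ be a measure on $M$ with a continuous positive density with respect to the Riemannian volume (for instance the Riemannian volume itself). Fix $z\in M$ and let $\pi_M=\pi_1(M,z)/Z(\pi_1(M,z))$, where in a product $ab$ of classes of loops $b$ is traversed first. *Isotopies.* An isotopy of a homeomorphism $g$ of $M$ is a continuous family $\{g^t\}_{0\le t\le 1}$ of homeomorphisms with $g^0=\mathrm{id}$, $g^1=g$. Let $\mathrm{Homeo}_0(M,\mu)$ be the group of $\mu$-preserving homeomorphisms that have an isotopy which is the identity outside a compact set independent of $t$, and let $\mathcal T_M$ be any subgroup of it. *Fragmentation norm.* Let $U\subset M$ be open with $\mu(U)<\infty$, and let $\mathcal S_U$ be the set of $h\in\mathcal T_M$ that have an isotopy $\{h^t\}$ with $\operatorname{supp}(h^t)\subset U$ for every $t$. For $g\in\mathcal T_M$ let $\nu_U(g)$ be the least $k$ such that $g=(f_1^{-1}h_1f_1)\cdots(f_k^{-1}h_kf_k)$ with $f_i\in\mathcal T_M$, $h_i\in\mathcal S_U$, and $\nu_U(g)=\infty$ if there is no such $k$. *Cochains.* For a group $G$, a homogeneous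 $n$-cochain is a function $c\colon G^{n+1}\to\mathbb R$ with $c(g_0h,\dots,g_nh)=c(g_0,\dots,g_n)$; it is alternating if $c(g_{\sigma(0)},\dots,g_{\sigma(n)})=\operatorname{sgn}(\sigma)c(g_0,\dots,g_n)$ for all permutations $\sigma$. $C^n_{b,\mathrm{alt}}(G)$ is the set of bounded alternating homogeneous $n$-cochains. For a pseudo norm $\nu\colon G\to[0,\infty)$ and $0\le d<n$, $C^n_{(d),\mathrm{alt}}(G,\nu)$ is the set of alternating homogeneous $n$-cochains $c$ for which there are $C,D\ge0$ with $$|c(g_0,\dots,g_n)|\le C\min_{I\subset\{1,\dots,n\},\ \#I=n-d}\ \sum_{i\in I}\nu(g_{i-1}^{-1}g_i)+D\qquad\text{for all } g_0,\dots,g_n\in G.$$ *The cochain $\Phi_{BM}(c)$.* Choose a path $\delta_x$ from $z$ to $x$ for each $x\in M$, Borel measurable in $x$, such that $\delta_x$ is the (unique) minimizing geodesic whenever $x$ is not in the cut locus of $z$ (on the cut locus, which is a null set, the choice is arbitrary). For $g\in\mathcal T_M$ and $x\in M$ let $\gamma(g,x)\in\pi_M$ be the class of the loop that runs along $\delta_x$,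 then along $t\mapsto g^t(x)$ for an isotopy $\{g^t\}$ of $g$, then back along $\delta_{g(x)}$; in $\pi_M$ it does not depend on the isotopy. Put $$\Phi_{BM}(c)(g_0,\dots,g_n)=\int_M c(\gamma(g_0,x),\dots,\gamma(g_n,x))\,d\mu(x).$$ **Proposition.** Let $n\ge1$ and $c\in C^n_{b,\mathrm{alt}}(\pi_M)$. Families $\{\delta_x\}$ as above exist, and for each of them the following holds. The integrand in the definition of $\Phi_{BM}(c)(g_0,\dots,g_n)$ is integrable for all $g_0,\dots,g_n\in\mathcal T_M$, and there is $C\ge0$ such that $$|\Phi_{BM}(c)(g_0,\dots,g_n)|\le C\cdot\min_{0\le i<j\le n}\nu_U(g_i^{-1}g_j)\qquad\text{for all } g_0,\dots,g_n\in\mathcal T_M .$$ In particular, if $\nu_U$ is finite on $\mathcal T_M$, then $\nu_U$ is a pseudo norm and $\Phi_{BM}(c)\in C^n_{(n-1),\mathrm{alt}}(\mathcal T_M,\nu_U)$. -/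

import Mathlib

open MeasureTheory Bundle Manifold
open scoped ENNReal NNReal ContDiff

noncomputable section

/-! ### Homogeneous cochains, and norm controlled cochains -/

section Cochains

variable {G : Type*} [Group G] {n : ℕ}

/-- Homogeneous `n`-cochains: `c (g₀ h, …, gₙ h) = c (g₀, …, gₙ)`. -/
def homogeneousCochains (G : Type*) [Group G] (n : ℕ) : Set ((Fin (n + 1) → G) → ℝ) :=
  {c | ∀ (g : Fin (n + 1) → G) (h : G), c (fun i => g i * h) = c g}

/-- Alternating homogeneous `n`-cochains. -/
def alternatingCochains (G : Type*) [Group G] (n : ℕ) : Set ((Fin (n + 1) → G) → ℝ) :=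
  {c | c ∈ homogeneousCochains G n ∧
    ∀ (g : Fin (n + 1) → G) (σ : Equiv.Perm (Fin (n + 1))),
      c (fun i => g (σ i)) = ((Equiv.Perm.sign σ : ℤ) : ℝ) * c g}

/-- The space `C_{b,alt}^n(G)` of bounded alternating homogeneous `n`-cochains. -/
def boundedAlternatingCochains (G : Type*) [Group G] (n : ℕ) : Set ((Fin (n + 1) → G) → ℝ) :=
  {c | c ∈ alternatingCochains G n ∧ ∃ B : ℝ, ∀ g, |c g| ≤ B}

/-- The minimum of `∑_{i ∈ I} ν (g_{i-1}⁻¹ g_i)` over the subsets `I ⊆ {1, …, n}` with `n - d`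
elements (the index `i : Fin n` stands for `i + 1 ∈ {1, …, n}`). When `d ≥ n` only `I = ∅` occurs
and the value is `0`. -/
def levelMin (d : ℕ) (ν : GroupSeminorm G) (g : Fin (n + 1) → G) : ℝ :=
  ⨅ I : {I : Finset (Fin n) // I.card = n - d},
    ∑ i ∈ I.1, ν ((g i.castSucc)⁻¹ * g i.succ)

/-- The space `C_{(d)}^n(G, ν)` of homogeneous norm controlled `n`-cochains of level `d`. For
`d ≥ n` these are the bounded homogeneous cochains. -/
def normControlledCochains (n d : ℕ) (ν : GroupSeminorm G) : Set ((Fin (n + 1) → G) → ℝ) :=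
  {c | c ∈ homogeneousCochains G n ∧
    ∃ C D : ℝ, 0 ≤ C ∧ 0 ≤ D ∧ ∀ g, |c g| ≤ C * levelMin d ν g + D}

/-- The space `C_{(d),alt}^n(G, ν)`. -/
def normControlledAlternatingCochains (n d : ℕ) (ν : GroupSeminorm G) :
    Set ((Fin (n + 1) → G) → ℝ) :=
  normControlledCochains n d ν ∩ alternatingCochains G n

end Cochains

/-! ### Isotopies and transformation groups -/

section Isotopies

variable {M : Type*} [TopologicalSpace M]

/-- An isotopy from the identity to `g`: a family of homeomorphisms `g^t`, `0 ≤ t ≤ 1`, with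
`g^0 = id` and `g^1 = g`, such that `g^t(x)` and `(g^t)⁻¹(x)` are continuous in `(t, x)`. -/
structure Isotopy (g : M ≃ₜ M) where
  map : unitInterval → (M ≃ₜ M)
  map_zero : map 0 = 1
  map_one : map 1 = g
  continuous_map : Continuous fun p : unitInterval × M => map p.1 p.2
  continuous_symm : Continuous fun p : unitInterval × M => (map p.1).symm p.2

namespace Isotopy

/-- The constant isotopy. -/
def refl : Isotopy (1 : M ≃ₜ M) where
  map _ := 1
  map_zero := rfl
  map_one := rfl
  continuous_map := continuous_snd
  continuous_symm := continuous_snd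

/-- The pointwise composition of two isotopies. -/
def mul {g h : M ≃ₜ M} (H : Isotopy g) (K : Isotopy h) : Isotopy (g * h) where
  map t := H.map t * K.map t
  map_zero := by rw [H.map_zero, K.map_zero, one_mul]
  map_one := by rw [H.map_one, K.map_one]
  continuous_map := H.continuous_map.comp (continuous_fst.prodMk K.continuous_map)
  continuous_symm := K.continuous_symm.comp (continuous_fst.prodMk H.continuous_symm)

/-- The pointwise inverse of an isotopy. -/
def inv {g : M ≃ₜ M} (H : Isotopy g) : Isotopy g⁻¹ where
  map t := (H.map t)⁻¹
  map_zero := by rw [H.map_zero, inv_one]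
  map_one := by rw [H.map_one]
  continuous_map := H.continuous_symm
  continuous_symm := H.continuous_map

/-- The path `t ↦ g^t(x)` from `x` to `g(x)`. -/
def trace {g : M ≃ₜ M} (H : Isotopy g) (x : M) : Path x (g x) where
  toFun t := H.map t x
  continuous_toFun := H.continuous_map.comp (continuous_id.prodMk continuous_const)
  source' := by simp [H.map_zero]
  target' := by simp [H.map_one]

/-- The isotopy is the identity outside a compact set that does not depend on the time. -/
def IsCompactlySupported {g : M ≃ₜ M} (H : Isotopy g) : Prop :=
  ∃ K : Set M, IsCompact K ∧ ∀ t, ∀ x ∉ K, H.map t x = x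

end Isotopy

/-- The (closed) support of a homeomorphism. -/
def homeoSupport (g : M ≃ₜ M) : Set M := closure {x | g x ≠ x}

theorem homeoSupport_inv (g : M ≃ₜ M) : homeoSupport g⁻¹ = homeoSupport g := by
  have h : {x | g⁻¹ x ≠ x} = {x | g x ≠ x} := by
    ext x
    simp only [Set.mem_ofPred_eq, ne_eq, not_iff_not, Homeomorph.inv_apply]
    rw [Homeomorph.symm_apply_eq, eq_comm]
  rw [homeoSupport, homeoSupport, h]

/-- The group `Homeo₀(M, μ)` of the homeomorphisms that preserve `μ` and are isotopic to the
identity through a compactly supported isotopy. -/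
def homeoZero [MeasurableSpace M] [BorelSpace M] (μ : Measure M) : Subgroup (M ≃ₜ M) where
  carrier := {g | MeasurePreserving g μ μ ∧ ∃ H : Isotopy g, H.IsCompactlySupported}
  one_mem' := ⟨MeasurePreserving.id μ, Isotopy.refl, ∅, isCompact_empty, fun _ _ _ => rfl⟩
  mul_mem' := by
    rintro g h ⟨hg, H, K, hK, hH⟩ ⟨hh, H', K', hK', hH'⟩
    refine ⟨hg.comp hh, H.mul H', K ∪ K', hK.union hK', fun t x hx => ?_⟩
    rw [Set.mem_union, not_or] at hx
    change H.map t (H'.map t x) = x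
    rw [hH' t x hx.2, hH t x hx.1]
  inv_mem' := by
    rintro g ⟨hg, H, K, hK, hH⟩
    refine ⟨MeasurePreserving.symm g.toMeasurableEquiv hg, H.inv, K, hK, fun t x hx => ?_⟩
    change (H.map t).symm x = x
    rw [Homeomorph.symm_apply_eq, hH t x hx]

end Isotopies

/-! ### The fragmentation norm -/

section Fragmentation

variable {M : Type*} [TopologicalSpace M]

/-- The set `S_U` of the `h ∈ T` that have an isotopy supported in `U` at every time. -/
def fragmentSet (T : Subgroup (M ≃ₜ M)) (U : Set M) : Set T :=
  {h | ∃ H : Isotopy (h : M ≃ₜ M), ∀ t, homeoSupport (H.map t) ⊆ U}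

/-- The elements `f⁻¹ h f` with `f ∈ T` and `h ∈ S_U`. -/
def conjugatedFragments (T : Subgroup (M ≃ₜ M)) (U : Set M) : Set T :=
  {k | ∃ f h : T, h ∈ fragmentSet T U ∧ k = f⁻¹ * h * f}

/-- The fragmentation norm `ν_U(g)`: the least `k` such that `g` is a product of `k` elements of
the form `f⁻¹ h f` with `f ∈ T`, `h ∈ S_U`, and `∞` if there is no such product. -/
def fragmentationNorm (T : Subgroup (M ≃ₜ M)) (U : Set M) (g : T) : ℕ∞ :=
  ⨅ (l : List T) (_ : (∀ k ∈ l, k ∈ conjugatedFragments T U) ∧ l.prod = g), (l.length : ℕ∞)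

/-- `ν_U` is well-defined on `T`, that is, finite everywhere. -/
def FragmentationNormFinite (T : Subgroup (M ≃ₜ M)) (U : Set M) : Prop :=
  ∀ g : T, fragmentationNorm T U g < ⊤

theorem conjugatedFragments_inv {T : Subgroup (M ≃ₜ M)} {U : Set M} {k : T}
    (hk : k ∈ conjugatedFragments T U) : k⁻¹ ∈ conjugatedFragments T U := by
  obtain ⟨f, h, ⟨H, hH⟩, rfl⟩ := hk
  refine ⟨f, h⁻¹, ⟨H.inv, fun t => ?_⟩, by group⟩
  change homeoSupport (H.map t)⁻¹ ⊆ U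
  rw [homeoSupport_inv]
  exact hH t

theorem fragmentationNorm_le {T : Subgroup (M ≃ₜ M)} {U : Set M} (l : List T)
    (hl : ∀ k ∈ l, k ∈ conjugatedFragments T U) :
    fragmentationNorm T U l.prod ≤ l.length :=
  iInf₂_le (f := fun (l' : List T)
    (_ : (∀ k ∈ l', k ∈ conjugatedFragments T U) ∧ l'.prod = l.prod) => (l'.length : ℕ∞))
    l ⟨hl, rfl⟩

theorem exists_list_of_fragmentationNorm_lt_top {T : Subgroup (M ≃ₜ M)} {U : Set M} {g : T}
    (hg : fragmentationNorm T U g < ⊤) :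
    ∃ l : List T, (∀ k ∈ l, k ∈ conjugatedFragments T U) ∧ l.prod = g ∧
      fragmentationNorm T U g = l.length := by
  have hne : Nonempty {l : List T // (∀ k ∈ l, k ∈ conjugatedFragments T U) ∧ l.prod = g} := by
    by_contra hcon
    rw [not_nonempty_iff, isEmpty_subtype] at hcon
    refine hg.ne ?_
    simp only [fragmentationNorm]
    exact iInf₂_eq_top.2 fun l hl => absurd hl (hcon l)
  obtain ⟨⟨l, hl⟩, hle⟩ := ciInf_mem
    fun l : {l : List T // (∀ k ∈ l, k ∈ conjugatedFragments T U) ∧ l.prod = g} =>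
      (l.1.length : ℕ∞)
  exact ⟨l, hl.1, hl.2, by rw [fragmentationNorm, iInf_subtype']; exact hle.symm⟩

theorem fragmentationNorm_inv_le {T : Subgroup (M ≃ₜ M)} {U : Set M}
    (hfin : FragmentationNormFinite T U) (g : T) :
    fragmentationNorm T U g⁻¹ ≤ fragmentationNorm T U g := by
  obtain ⟨l, hl, rfl, hlen⟩ := exists_list_of_fragmentationNorm_lt_top (hfin g)
  rw [hlen, List.prod_inv_reverse]
  refine (fragmentationNorm_le _ ?_).trans (by simp)
  intro k hk
  simp only [List.mem_reverse, List.mem_map] at hk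
  obtain ⟨a, ha, rfl⟩ := hk
  exact conjugatedFragments_inv (hl a ha)

/-- The fragmentation norm as a pseudo norm `T → [0, ∞)`, when it is finite everywhere. -/
def fragmentationSeminorm (T : Subgroup (M ≃ₜ M)) (U : Set M)
    (hfin : FragmentationNormFinite T U) : GroupSeminorm T where
  toFun g := ((fragmentationNorm T U g).toNat : ℝ)
  map_one' := by
    have h : fragmentationNorm T U 1 ≤ 0 := by
      simpa using fragmentationNorm_le (T := T) (U := U) [] (by simp)
    simp [nonpos_iff_eq_zero.1 h]
  mul_le' g h := by
    obtain ⟨l, hl, rfl, hlen⟩ := exists_list_of_fragmentationNorm_lt_top (hfin g)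
    obtain ⟨l', hl', rfl, hlen'⟩ := exists_list_of_fragmentationNorm_lt_top (hfin h)
    have key : fragmentationNorm T U (l.prod * l'.prod) ≤ ((l.length + l'.length : ℕ) : ℕ∞) := by
      rw [← List.prod_append, ← List.length_append]
      refine fragmentationNorm_le _ fun k hk => ?_
      rcases List.mem_append.1 hk with hk | hk
      · exact hl k hk
      · exact hl' k hk
    rw [hlen, hlen']
    have := ENat.toNat_le_of_le_natCast key
    simp only [ENat.toNat_natCast]
    exact_mod_cast this
  inv' g := by
    have h : fragmentationNorm T U g⁻¹ = fragmentationNorm T U g :=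
      le_antisymm (fragmentationNorm_inv_le hfin g)
        (by simpa using fragmentationNorm_inv_le hfin g⁻¹)
    rw [h]

end Fragmentation

/-! ### The Brandenbursky–Marcinkowski cochain -/

section BrandenburskyMarcinkowski

/-- Minimizing geodesics from `x` to `y`, parametrized on `[0, 1]` proportionally to arc length. -/
def IsMinimizingGeodesic {M : Type*} [MetricSpace M] {x y : M} (σ : Path x y) : Prop :=
  ∀ s t : unitInterval, dist (σ s) (σ t) = dist x y * |(s : ℝ) - t|

/-- The cut locus of `z`: the points `x` at which the minimizing geodesics from `z` stop being
minimizing, that is, no minimizing geodesic from `z` passes through `x` before its endpoint.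
(The point `z` itself is not in it, because of the constant geodesic.) -/
def cutLocus {M : Type*} [MetricSpace M] (z : M) : Set M :=
  {x | ∀ (y : M) (σ : Path z y), IsMinimizingGeodesic σ → ∀ s : unitInterval, σ s = x → s = 1}

/-- A Borel family of paths `δ x` from `z` to `x` such that `δ x` is the minimizing geodesic
(which is unique) whenever `x` is not in the cut locus of `z`. On the cut locus, a null set, the
path `δ x` is arbitrary. -/
structure IsGeodesicFamily {M : Type*} [MetricSpace M] [MeasurableSpace M] (z : M)
    (δ : ∀ x : M, Path z x) : Prop where
  minimizing : ∀ x ∉ cutLocus z, IsMinimizingGeodesic (δ x)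
  measurable : ∀ t : unitInterval, Measurable fun x => δ x t

/-- The group `π_M`: the fundamental group modulo its center. The product in Mathlib's fundamental
group is the one for which `a * b` runs first along `b` and then along `a`. -/
abbrev CentralQuotient {M : Type*} [TopologicalSpace M] (z : M) : Type _ :=
  FundamentalGroup M z ⧸ Subgroup.center (FundamentalGroup M z)

variable {M : Type*} [TopologicalSpace M] {z : M}

/-- The loop from `z` along `δ x` to `x`, along `t ↦ g^t(x)` to `g(x)`, and back along
`δ (g x)`. -/
def isotopyLoop (δ : ∀ x : M, Path z x) {g : M ≃ₜ M} (H : Isotopy g) (x : M) : Path z z :=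
  ((δ x).trans (H.trace x)).trans (δ (g x)).symm

open Classical in
/-- The element `γ(g, x)` of `π_M`: the class of the loop above for some isotopy of `g`. -/
def gammaBM (δ : ∀ x : M, Path z x) (g : M ≃ₜ M) (x : M) : CentralQuotient z :=
  if h : Nonempty (Isotopy g) then
    QuotientGroup.mk (FundamentalGroup.fromPath
      (Path.Homotopic.Quotient.mk (isotopyLoop δ h.some x)))
  else 1

/-- The integrand `x ↦ c (γ(g₀, x), …, γ(gₙ, x))`. -/
def integrandBM {n : ℕ} (δ : ∀ x : M, Path z x) {T : Subgroup (M ≃ₜ M)}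
    (c : (Fin (n + 1) → CentralQuotient z) → ℝ) (g : Fin (n + 1) → T) (x : M) : ℝ :=
  c fun i => gammaBM δ (g i : M ≃ₜ M) x

/-- The cochain `Φ_BM(c)` on `T`. -/
def phiBM {n : ℕ} [MeasurableSpace M] (μ : Measure M) (δ : ∀ x : M, Path z x)
    (T : Subgroup (M ≃ₜ M)) (c : (Fin (n + 1) → CentralQuotient z) → ℝ)
    (g : Fin (n + 1) → T) : ℝ :=
  ∫ x, integrandBM δ c g x ∂μ

end BrandenburskyMarcinkowski

end

/-! The estimate comes from the cocycle rule γ(gh, x) = γ(g, h(x)) γ(h, x) (`gammaBM_mul`) and from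
the triviality of γ(k, x) when some isotopy of k fixes x at all times (`gammaBM_eq_one`). A
conjugated fragment f⁻¹hf has such an isotopy at every x outside f⁻¹(U), a set of measure μ(U).
Hence, if g_i⁻¹g_j is a product of k conjugated fragments, then outside a set of measure at most k
μ(U) it fixes x and has trivial γ, so γ(g_i, x) = γ(g_j, x). There the integrand vanishes because c
is alternating. Elsewhere it is at most sup |c|, so |Φ_BM(c)| ≤ sup |c| · μ(U) · ν_U(g_i⁻¹g_j)
(`ofReal_abs_phiBM_le`).

The class γ is well defined modulo the center because every isotopy of g slides a loop β at x to the
same loop g∘β (`exists_isotopyLoop_mul`).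

Integrability needs a measurable bounded integrand living on a set of finite measure. Homotopy
classes are locally constant on the space of paths of a manifold (`Path.eventually_homotopic`), so
the integrand is a continuous function of finitely many Borel families of loops. It vanishes outside
a compact set, which has finite measure since inverse charts are locally Lipschitz.

For the existence of δ, completeness gives compact balls (Hopf–Rinow), hence midpoints, which a
selection theorem makes Borel; iterating them over dyadic parameters and passing to the limit gives
Borel minimizing geodesics. -/

/-! ### Length metrics, Hopf–Rinow and midpoints -/

section LengthMetric

open Set Metric

/-- A metric for which points at distance less than `r + s` are joined through a point at distance
at most `r` from the first one and at most `s` from the second one. -/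
def IsLengthMetric (M : Type*) [MetricSpace M] : Prop :=
  ∀ (x y : M) (r s : ℝ), 0 ≤ r → 0 ≤ s → dist x y < r + s → ∃ w, dist x w ≤ r ∧ dist w y ≤ s

/-- Cut a curve of length less than r + s at a point at distance exactly r from x: the first piece
has length at least r, so less than s remains. -/
theorem isLengthMetric_of_isRiemannianManifold {E H M : Type*} [NormedAddCommGroup E]
    [NormedSpace ℝ E] [TopologicalSpace H] (I : ModelWithCorners ℝ E H) [MetricSpace M]
    [ChartedSpace H M] [IsManifold I 1 M] [RiemannianBundle (fun x : M => TangentSpace I x)]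
    [IsRiemannianManifold I M] : IsLengthMetric M := by
  intro x y r s hr hs hxy
  rcases le_or_gt (dist x y) r with h | h
  · exact ⟨y, h, by simpa using hs⟩
  have hlt : riemannianEDist I x y < ENNReal.ofReal (r + s) := by
    rw [← IsRiemannianManifold.out (I := I) x y, edist_dist]
    exact (ENNReal.ofReal_lt_ofReal_iff (by linarith [dist_nonneg (x := x) (y := y)])).2 hxy
  obtain ⟨γ, h0, h1, hγ, hlen⟩ := exists_lt_of_riemannianEDist_lt hlt
  have hcont : ContinuousOn (fun t => dist x (γ t)) (Icc 0 1) :=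
    (continuous_const.dist continuous_id).comp_continuousOn hγ.continuousOn
  obtain ⟨t, ht, hxt⟩ := intermediate_value_Icc zero_le_one hcont
    (show r ∈ Icc (dist x (γ 0)) (dist x (γ 1)) by
      rw [h0, h1, dist_self]; exact ⟨hr, h.le⟩)
  refine ⟨γ t, hxt.le, ?_⟩
  have ha : edist x (γ t) ≤ pathELength I γ 0 t := by
    rw [IsRiemannianManifold.out (I := I)]
    exact riemannianEDist_le_pathELength (hγ.mono (Icc_subset_Icc_right ht.2)) h0 rfl ht.1
  have hb : edist (γ t) y ≤ pathELength I γ t 1 := by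
    rw [IsRiemannianManifold.out (I := I)]
    exact riemannianEDist_le_pathELength (hγ.mono (Icc_subset_Icc_left ht.1)) rfl h1 ht.2
  have hsum : edist x (γ t) + edist (γ t) y < ENNReal.ofReal (r + s) := by
    refine lt_of_le_of_lt (add_le_add ha hb) ?_
    rwa [pathELength_add ht.1 ht.2]
  rw [edist_dist, edist_dist, ← ENNReal.ofReal_add dist_nonneg dist_nonneg] at hsum
  have := (ENNReal.ofReal_lt_ofReal_iff_of_nonneg (by positivity)).1 hsum
  simp only at hxt
  linarith

variable {M : Type*} [MetricSpace M]

theorem IsLengthMetric.isCompact_closedBall_of_lt [CompleteSpace M] (hM : IsLengthMetric M) {z : M}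
    {r : ℝ} (hr : 0 < r) (h : ∀ s, 0 ≤ s → s < r → IsCompact (closedBall z s)) :
    IsCompact (closedBall z r) := by
  refine TotallyBounded.isCompact_of_isClosed ?_ isClosed_closedBall
  refine totallyBounded_iff.2 fun ε hε => ?_
  -- Points of the ball of radius r are within 2η ≤ ε/2 of the compact ball of radius r - η; the
  -- bound r/2 keeps that radius nonnegative.
  set η := min (ε / 4) (r / 2) with hη
  have hη0 : 0 < η := by positivity
  have hη1 : η ≤ ε / 4 := min_le_left _ _
  have hη2 : η ≤ r / 2 := min_le_right _ _
  obtain ⟨t, ht, hcov⟩ := totallyBounded_iff.1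
    (h (r - η) (by linarith) (by linarith)).totallyBounded (ε / 2) (by positivity)
  refine ⟨t, ht, fun x hx => ?_⟩
  obtain ⟨w, hw1, hw2⟩ := hM z x (r - η) (2 * η) (by linarith) (by linarith)
    (by rw [dist_comm]; linarith [mem_closedBall.1 hx])
  have := hcov (show w ∈ closedBall z (r - η) by rwa [mem_closedBall, dist_comm])
  simp only [mem_iUnion, mem_ball, exists_prop] at this ⊢
  obtain ⟨y, hy, hwy⟩ := this
  refine ⟨y, hy, ?_⟩
  have := dist_triangle x w y
  rw [dist_comm x w] at this
  linarith

theorem IsLengthMetric.exists_isCompact_closedBall_add [LocallyCompactSpace M]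
    (hM : IsLengthMetric M) {z : M} {r : ℝ} (hr : 0 ≤ r) (h : IsCompact (closedBall z r)) :
    ∃ ε > 0, IsCompact (closedBall z (r + ε)) := by
  obtain ⟨δ, hδ, hc⟩ := h.exists_isCompact_cthickening
  refine ⟨δ / 2, by positivity, hc.of_isClosed_subset isClosed_closedBall fun x hx => ?_⟩
  obtain ⟨w, hw1, hw2⟩ := hM z x r δ hr hδ.le (by
    rw [dist_comm]; linarith [mem_closedBall.1 hx])
  refine mem_cthickening_of_dist_le x w δ _ (by rwa [mem_closedBall, dist_comm]) ?_
  rwa [dist_comm]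

/-- The Hopf–Rinow theorem for length metrics. -/
theorem IsLengthMetric.properSpace [CompleteSpace M] [LocallyCompactSpace M]
    (hM : IsLengthMetric M) : ProperSpace M := by
  refine ⟨fun z R => ?_⟩
  by_contra hR
  -- The infimum of the bad radii is itself good, since all smaller radii are, and then some larger
  -- radius is good too: a contradiction.
  set A := {r : ℝ | 0 ≤ r ∧ ¬ IsCompact (closedBall z r)}
  have hR0 : 0 ≤ R := by
    by_contra hneg
    exact hR (by rw [closedBall_eq_empty.2 (not_le.1 hneg)]; exact isCompact_empty)
  have hA : A.Nonempty := ⟨R, hR0, hR⟩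
  have hbdd : BddBelow A := ⟨0, fun r hr => hr.1⟩
  set r := sInf A
  have hr0 : 0 ≤ r := le_csInf hA fun r hr => hr.1
  have hlt : ∀ s, 0 ≤ s → s < r → IsCompact (closedBall z s) := fun s hs hsr => by
    by_contra hcon
    exact absurd (csInf_le hbdd ⟨hs, hcon⟩) (not_le.2 hsr)
  have hr : IsCompact (closedBall z r) := by
    rcases hr0.eq_or_lt with h | h
    · rw [← h, closedBall_zero]
      exact isCompact_singleton
    · exact hM.isCompact_closedBall_of_lt h hlt
  obtain ⟨ε, hε, hc⟩ := hM.exists_isCompact_closedBall_add hr0 hr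
  obtain ⟨s, hs, hsr⟩ := exists_lt_of_csInf_lt hA (show sInf A < r + ε by linarith)
  exact hs.2 (hc.of_isClosed_subset isClosed_closedBall (closedBall_subset_closedBall hsr.le))

/-- The sets of approximate midpoints are nonempty, compact and decreasing, so they have a common
point. -/
theorem IsLengthMetric.exists_midpoint [ProperSpace M] (hM : IsLengthMetric M) (x y : M) :
    ∃ w, dist x w ≤ dist x y / 2 ∧ dist w y ≤ dist x y / 2 := by
  set d := dist x y
  let K : ℕ → Set M := fun n =>
    closedBall x (d / 2 + 1 / (n + 1)) ∩ closedBall y (d / 2 + 1 / (n + 1))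
  have hd : 0 ≤ d := dist_nonneg
  obtain ⟨w, hw⟩ := IsCompact.nonempty_iInter_of_sequence_nonempty_isCompact_isClosed K
    (fun n => by
      have : (1 : ℝ) / ((n + 1 : ℕ) + 1) ≤ 1 / (n + 1) := by
        push_cast
        exact one_div_le_one_div_of_le (by positivity) (by linarith)
      exact inter_subset_inter (closedBall_subset_closedBall (by linarith))
        (closedBall_subset_closedBall (by linarith)))
    (fun n => by
      have hn : (0 : ℝ) < 1 / (n + 1) := by positivity
      obtain ⟨w, h1, h2⟩ := hM x y (d / 2 + 1 / (n + 1)) (d / 2 + 1 / (n + 1)) (by positivity)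
        (by positivity) (by linarith)
      exact ⟨w, by rwa [mem_closedBall, dist_comm], h2⟩)
    ((isCompact_closedBall _ _).inter_right isClosed_closedBall)
    (fun n => isClosed_closedBall.inter isClosed_closedBall)
  rw [mem_iInter] at hw
  have hlim : Filter.Tendsto (fun n : ℕ => d / 2 + 1 / ((n : ℝ) + 1)) Filter.atTop
      (nhds (d / 2)) := by
    simpa using (tendsto_const_nhds (x := d / 2)).add
      (tendsto_one_div_add_atTop_nhds_zero_nat (𝕜 := ℝ))
  refine ⟨w, ge_of_tendsto' hlim fun n => ?_, ge_of_tendsto' hlim fun n => ?_⟩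
  · rw [dist_comm]
    exact (hw n).1
  · exact (hw n).2

end LengthMetric

/-! ### Measurable selection -/

section Selection

open Set Metric

/-- A closed and nonempty valued correspondence such that the set of points whose value meets a
given closed set is measurable. -/
structure HitMeasurable {X Y : Type*} [MeasurableSpace X] [TopologicalSpace Y]
    (S : X → Set Y) : Prop where
  isClosed : ∀ x, IsClosed (S x)
  nonempty : ∀ x, (S x).Nonempty
  measurableSet_hit : ∀ C, IsClosed C → MeasurableSet {x | (S x ∩ C).Nonempty}

variable {X Y : Type*} [MeasurableSpace X] [MetricSpace Y] [MeasurableSpace Y]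

/-- Let `u x` be the first point of a dense sequence whose r-ball meets `S x`. It takes countably
many values, so the new hitting sets are countable unions of measurable pieces. -/
theorem HitMeasurable.exists_inter_closedBall [TopologicalSpace.SeparableSpace Y] {S : X → Set Y}
    (hS : HitMeasurable S) {r : ℝ} (hr : 0 < r) :
    ∃ u : X → Y, Measurable u ∧ HitMeasurable fun x => S x ∩ closedBall (u x) r := by
  classical
  rcases isEmpty_or_nonempty X with hX | ⟨⟨x₀⟩⟩
  · exact ⟨fun x => isEmptyElim x, measurable_of_empty _,
      fun x => isEmptyElim x, fun x => isEmptyElim x, fun C _ => by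
        rw [eq_empty_of_isEmpty {x | ((S x ∩ closedBall _ r) ∩ C).Nonempty}]
        exact MeasurableSet.empty⟩
  have : Nonempty Y := ⟨(hS.nonempty x₀).some⟩
  set q := TopologicalSpace.denseSeq Y
  have hex : ∀ x, ∃ n, (S x ∩ closedBall (q n) r).Nonempty := fun x => by
    obtain ⟨y, hy⟩ := hS.nonempty x
    obtain ⟨n, hn⟩ := (TopologicalSpace.denseRange_denseSeq Y).exists_dist_lt y hr
    exact ⟨n, y, hy, hn.le⟩
  have hmeas : Measurable fun x => Nat.find (hex x) :=
    measurable_find _ fun n => hS.measurableSet_hit _ isClosed_closedBall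
  refine ⟨fun x => q (Nat.find (hex x)), (measurable_from_nat (f := q)).comp hmeas,
    fun x => (hS.isClosed x).inter isClosed_closedBall, fun x => Nat.find_spec (hex x),
    fun C hC => ?_⟩
  have : {x | ((S x ∩ closedBall (q (Nat.find (hex x))) r) ∩ C).Nonempty} =
      ⋃ n, {x | Nat.find (hex x) = n} ∩ {x | (S x ∩ (closedBall (q n) r ∩ C)).Nonempty} := by
    ext x
    simp [inter_assoc]
  rw [this]
  exact MeasurableSet.iUnion fun n => (hmeas (measurableSet_singleton n)).inter
    (hS.measurableSet_hit _ (isClosed_closedBall.inter hC))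

/-- The Kuratowski–Ryll-Nardzewski selection theorem. -/
theorem HitMeasurable.exists_measurable_selection [BorelSpace Y] [TopologicalSpace.SeparableSpace Y]
    [CompleteSpace Y] {S : X → Set Y} (hS : HitMeasurable S) :
    ∃ u : X → Y, Measurable u ∧ ∀ x, u x ∈ S x := by
  rcases isEmpty_or_nonempty X with hX | ⟨⟨x₀⟩⟩
  · exact ⟨fun x => isEmptyElim x, measurable_of_empty _, fun x => isEmptyElim x⟩
  have : Nonempty Y := ⟨(hS.nonempty x₀).some⟩
  choose! v hvm hv using fun (S : X → Set Y) (n : ℕ) (hS : HitMeasurable S) =>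
    hS.exists_inter_closedBall (r := (1 / 2 : ℝ) ^ n) (by positivity)
  -- Shrink `S` by successive balls of radius 2⁻ᵏ. A point of `R (n + 2)` lies in both balls n and n
  -- + 1, which makes the centers Cauchy.
  let R : ℕ → X → Set Y := fun n => Nat.rec S
    (fun k Sk x => Sk x ∩ closedBall (v Sk k x) ((1 / 2 : ℝ) ^ k)) n
  have hRs : ∀ n x, R (n + 1) x = R n x ∩ closedBall (v (R n) n x) ((1 / 2 : ℝ) ^ n) :=
    fun n x => rfl
  have hR : ∀ n, HitMeasurable (R n) := fun n => by
    induction n with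
    | zero => exact hS
    | succ k ih => exact hv (R k) k ih
  have hanti : ∀ x, Antitone fun n => R n x := fun x =>
    antitone_nat_of_succ_le fun n => by rw [hRs]; exact inter_subset_left
  choose w hw using fun n x => (hR n).nonempty x
  have hwv : ∀ n x, ∀ k, k < n → dist (w n x) (v (R k) k x) ≤ (1 / 2 : ℝ) ^ k := fun n x k hk => by
    have := hanti x (Nat.succ_le_of_lt hk) (hw n x)
    simp only [Nat.succ_eq_add_one] at this
    rw [hRs] at this
    exact this.2
  have hlim : ∀ x, ∃ y, Filter.Tendsto (fun n => v (R n) n x) Filter.atTop (nhds y) := fun x => by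
    refine cauchySeq_tendsto_of_complete (cauchySeq_of_le_geometric (1 / 2) 2 (by norm_num)
      fun n => ?_)
    have h1 := hwv (n + 2) x n (by omega)
    have h2 := hwv (n + 2) x (n + 1) (by omega)
    have h3 := dist_triangle_left (v (R n) n x) (v (R (n + 1)) (n + 1) x) (w (n + 2) x)
    rw [pow_succ] at h2
    linarith [pow_pos (show (0 : ℝ) < 1 / 2 by norm_num) n]
  choose u hu using hlim
  refine ⟨u, measurable_of_tendsto_metrizable (fun n => hvm (R n) n (hR n))
    (tendsto_pi_nhds.2 hu), fun x => ?_⟩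
  have hdist : Filter.Tendsto (fun n => dist (w (n + 1) x) (v (R n) n x)) Filter.atTop (nhds 0) :=
    squeeze_zero (fun _ => dist_nonneg) (fun n => hwv (n + 1) x n (by omega))
      (tendsto_pow_atTop_nhds_zero_of_lt_one (by norm_num) (by norm_num))
  have hwu : Filter.Tendsto (fun n => w (n + 1) x) Filter.atTop (nhds (u x)) := by
    refine (hu x).congr_dist ?_
    simpa only [dist_comm] using hdist
  exact (hS.isClosed x).mem_of_tendsto hwu
    (Filter.Eventually.of_forall fun n => hanti x (Nat.zero_le (n + 1)) (hw (n + 1) x))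

/-- For compact C the hitting set is the projection of a closed set along C, hence closed; a general
closed C is a countable union of compact sets. -/
theorem IsLengthMetric.exists_measurable_midpoint [BorelSpace Y] [ProperSpace Y] (hY : IsLengthMetric Y) :
    ∃ mid : Y × Y → Y, Measurable mid ∧ ∀ p : Y × Y,
      dist p.1 (mid p) ≤ dist p.1 p.2 / 2 ∧ dist (mid p) p.2 ≤ dist p.1 p.2 / 2 := by
  rcases isEmpty_or_nonempty Y with hY' | ⟨⟨y₀⟩⟩
  · exact ⟨fun p => p.1, measurable_fst, fun p => isEmptyElim p.1⟩
  let S : Y × Y → Set Y := fun p =>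
    {w | dist p.1 w ≤ dist p.1 p.2 / 2 ∧ dist w p.2 ≤ dist p.1 p.2 / 2}
  have hhit : ∀ C, IsCompact C → IsClosed {p | (S p ∩ C).Nonempty} := fun C hC => by
    have := isCompact_iff_compactSpace.1 hC
    have hcl : IsClosed {p : (Y × Y) × C | dist p.1.1 p.2 ≤ dist p.1.1 p.1.2 / 2 ∧
        dist (p.2 : Y) p.1.2 ≤ dist p.1.1 p.1.2 / 2} := by
      refine IsClosed.and ?_ ?_ <;> exact isClosed_le (by fun_prop) (by fun_prop)
    convert isClosedMap_fst_of_compactSpace _ hcl using 1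
    ext p
    constructor
    · rintro ⟨w, hw, hwC⟩
      exact ⟨(p, ⟨w, hwC⟩), hw, rfl⟩
    · rintro ⟨⟨p', w⟩, hw, rfl⟩
      exact ⟨w, hw, w.2⟩
  have hS : HitMeasurable S := by
    refine ⟨fun p => ?_, fun p => hY.exists_midpoint p.1 p.2, fun C hC => ?_⟩
    · refine IsClosed.and ?_ ?_ <;> exact isClosed_le (by fun_prop) (by fun_prop)
    have : {p | (S p ∩ C).Nonempty} =
        ⋃ n : ℕ, {p | (S p ∩ (closedBall y₀ n ∩ C)).Nonempty} := by
      ext p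
      simp only [mem_ofPred_eq, mem_iUnion]
      constructor
      · rintro ⟨w, hw, hwC⟩
        obtain ⟨n, hn⟩ := exists_nat_ge (dist w y₀)
        exact ⟨n, w, hw, hn, hwC⟩
      · rintro ⟨n, w, hw, -, hwC⟩
        exact ⟨w, hw, hwC⟩
    rw [this]
    exact MeasurableSet.iUnion fun n =>
      (hhit _ ((isCompact_closedBall _ _).inter_right hC)).measurableSet
  obtain ⟨mid, hm, hmid⟩ := hS.exists_measurable_selection
  exact ⟨mid, hm, hmid⟩

end Selection

/-! ### Geodesics by dyadic subdivision -/

section Dyadic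

variable {Y : Type*}

/-- The dyadic subdivisions of a segment from `z` to `x` obtained by iterating a midpoint map:
`dyadicPoint mid z x k j` is the point with parameter `j / 2 ^ k`. -/
def dyadicPoint (mid : Y × Y → Y) (z x : Y) : ℕ → ℕ → Y
  | 0, j => if j = 0 then z else x
  | k + 1, j =>
    if Even j then dyadicPoint mid z x k (j / 2)
    else mid (dyadicPoint mid z x k (j / 2), dyadicPoint mid z x k (j / 2 + 1))

variable (mid : Y × Y → Y) (z x : Y)

theorem dyadicPoint_succ_two_mul (k j : ℕ) :
    dyadicPoint mid z x (k + 1) (2 * j) = dyadicPoint mid z x k j := by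
  simp [dyadicPoint]

theorem dyadicPoint_succ_two_mul_add_one (k j : ℕ) :
    dyadicPoint mid z x (k + 1) (2 * j + 1) =
      mid (dyadicPoint mid z x k j, dyadicPoint mid z x k (j + 1)) := by
  have h : ¬ Even (2 * j + 1) := by simp
  have h2 : (2 * j + 1) / 2 = j := by omega
  simp [dyadicPoint, h2]

theorem dyadicPoint_zero_right (k : ℕ) : dyadicPoint mid z x k 0 = z := by
  induction k with
  | zero => simp [dyadicPoint]
  | succ k ih => simpa using (dyadicPoint_succ_two_mul mid z x k 0).trans ih

theorem dyadicPoint_two_pow (k : ℕ) : dyadicPoint mid z x k (2 ^ k) = x := by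
  induction k with
  | zero => simp [dyadicPoint]
  | succ k ih => rw [pow_succ', dyadicPoint_succ_two_mul, ih]

theorem measurable_dyadicPoint [MeasurableSpace Y] (hm : Measurable mid) (k j : ℕ) :
    Measurable fun x => dyadicPoint mid z x k j := by
  induction k generalizing j with
  | zero =>
    by_cases hj : j = 0
    · simp [dyadicPoint, hj]
    · simpa [dyadicPoint, hj] using measurable_id'
  | succ k ih =>
    by_cases hj : Even j
    · simpa [dyadicPoint, hj] using ih _
    · simp only [dyadicPoint, hj, if_false]
      exact hm.comp ((ih _).prodMk (ih _))

variable [MetricSpace Y]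

theorem dist_dyadicPoint_succ_le
    (hmid : ∀ p : Y × Y, dist p.1 (mid p) ≤ dist p.1 p.2 / 2 ∧ dist (mid p) p.2 ≤ dist p.1 p.2 / 2)
    (k j : ℕ) :
    dist (dyadicPoint mid z x k j) (dyadicPoint mid z x k (j + 1)) ≤ dist z x / 2 ^ k := by
  induction k generalizing j with
  | zero =>
    by_cases hj : j = 0
    · simp [dyadicPoint, hj]
    · simp [dyadicPoint, hj, dist_nonneg]
  | succ k ih =>
    rw [pow_succ, ← div_div]
    obtain ⟨i, rfl | rfl⟩ := Nat.even_or_odd' j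
    · rw [dyadicPoint_succ_two_mul, dyadicPoint_succ_two_mul_add_one]
      refine (hmid (_, _)).1.trans ?_
      gcongr
      exact ih i
    · rw [show 2 * i + 1 + 1 = 2 * (i + 1) by ring, dyadicPoint_succ_two_mul,
        dyadicPoint_succ_two_mul_add_one]
      refine (hmid (_, _)).2.trans ?_
      gcongr
      exact ih i

theorem dist_dyadicPoint_le
    (hmid : ∀ p : Y × Y, dist p.1 (mid p) ≤ dist p.1 p.2 / 2 ∧ dist (mid p) p.2 ≤ dist p.1 p.2 / 2)
    (k : ℕ) {i j : ℕ} (hij : i ≤ j) :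
    dist (dyadicPoint mid z x k i) (dyadicPoint mid z x k j) ≤
      ((j : ℝ) - i) * (dist z x / 2 ^ k) := by
  induction j, hij using Nat.le_induction with
  | base => simp
  | succ j hij ih =>
    have := dist_triangle (dyadicPoint mid z x k i) (dyadicPoint mid z x k j)
      (dyadicPoint mid z x k (j + 1))
    have := dist_dyadicPoint_succ_le mid z x hmid k j
    push_cast
    linarith

/-- Rounding to the grid costs at most one extra mesh, which disappears as k → ∞. -/
theorem dist_dyadicPoint_floor_le
    (hmid : ∀ p : Y × Y, dist p.1 (mid p) ≤ dist p.1 p.2 / 2 ∧ dist (mid p) p.2 ≤ dist p.1 p.2 / 2)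
    (k : ℕ) {s t : ℝ} (hs : 0 ≤ s) (hst : s ≤ t) :
    dist (dyadicPoint mid z x k ⌊2 ^ k * s⌋₊) (dyadicPoint mid z x k ⌊2 ^ k * t⌋₊) ≤
      dist z x * (t - s) + dist z x / 2 ^ k := by
  have h2 : (0 : ℝ) < 2 ^ k := by positivity
  refine (dist_dyadicPoint_le mid z x hmid k (Nat.floor_mono (by gcongr))).trans ?_
  have h3 := Nat.floor_le (show 0 ≤ 2 ^ k * t from by have := hs.trans hst; positivity)
  have h4 := Nat.lt_floor_add_one (2 ^ k * s)
  calc _ ≤ (2 ^ k * (t - s) + 1) * (dist z x / 2 ^ k) := by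
        gcongr
        linarith
    _ = _ := by field_simp

/-- Halving the finer floor gives the coarser one, so the point moves by at most one fine step. The
bound is geometric, so the dyadic approximations converge. -/
theorem dist_dyadicPoint_floor_succ_le
    (hmid : ∀ p : Y × Y, dist p.1 (mid p) ≤ dist p.1 p.2 / 2 ∧ dist (mid p) p.2 ≤ dist p.1 p.2 / 2)
    (k : ℕ) (t : ℝ) :
    dist (dyadicPoint mid z x k ⌊2 ^ k * t⌋₊) (dyadicPoint mid z x (k + 1) ⌊2 ^ (k + 1) * t⌋₊) ≤
      dist z x / 2 / 2 ^ k := by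
  have h : ⌊2 ^ k * t⌋₊ = ⌊2 ^ (k + 1) * t⌋₊ / 2 := by
    rw [← Nat.floor_div_natCast]
    congr 1
    push_cast
    ring
  rw [h, ← dyadicPoint_succ_two_mul]
  generalize ⌊2 ^ (k + 1) * t⌋₊ = j
  obtain ⟨i, rfl | rfl⟩ := Nat.even_or_odd' j
  · rw [show 2 * i / 2 = i by omega, dist_self]
    positivity
  · rw [show (2 * i + 1) / 2 = i by omega]
    refine (dist_dyadicPoint_succ_le mid z x hmid (k + 1) (2 * i)).trans (le_of_eq ?_)
    rw [pow_succ]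
    field_simp

end Dyadic

/-- In a proper length space, a minimizing geodesic from `z` to `x` can be chosen so that it depends
in a Borel measurable way on `x`. -/
theorem IsLengthMetric.exists_measurable_minimizingGeodesic {M : Type*} [MetricSpace M]
    [ProperSpace M] [MeasurableSpace M] [BorelSpace M] (hM : IsLengthMetric M) (z : M) :
    ∃ δ : ∀ x : M, Path z x, (∀ x, IsMinimizingGeodesic (δ x)) ∧
      ∀ t : unitInterval, Measurable fun x => δ x t := by
  obtain ⟨mid, hm, hmid⟩ := hM.exists_measurable_midpoint
  have hlim : ∀ (x : M) (t : unitInterval), ∃ y, Filter.Tendsto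
      (fun k => dyadicPoint mid z x k ⌊2 ^ k * (t : ℝ)⌋₊) Filter.atTop (nhds y) := fun x t =>
    cauchySeq_tendsto_of_complete
      (cauchySeq_of_le_geometric_two fun k => dist_dyadicPoint_floor_succ_le mid z x hmid k t)
  choose f hf using hlim
  have hf0 : ∀ x, f x 0 = z := fun x =>
    tendsto_nhds_unique (hf x 0) (by simp [dyadicPoint_zero_right])
  have hf1 : ∀ x, f x 1 = x := fun x => by
    refine tendsto_nhds_unique (hf x 1) ?_
    have : ∀ k : ℕ, ⌊(2 : ℝ) ^ k * ((1 : unitInterval) : ℝ)⌋₊ = 2 ^ k := fun k => by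
      rw [Set.Icc.coe_one, mul_one]
      exact_mod_cast Nat.floor_natCast (R := ℝ) (2 ^ k)
    simp only [this, dyadicPoint_two_pow]
    exact tendsto_const_nhds
  have hle : ∀ x (s t : unitInterval), s ≤ t → dist (f x s) (f x t) ≤ dist z x * ((t : ℝ) - s) :=
    fun x s t hst => by
      have h1 : Filter.Tendsto (fun k : ℕ => dist z x * ((t : ℝ) - s) + dist z x / 2 ^ k)
          Filter.atTop (nhds (dist z x * ((t : ℝ) - s))) := by
        have := tendsto_const_nhds (x := dist z x) (f := Filter.atTop (α := ℕ)) |>.div_atTop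
          (tendsto_pow_atTop_atTop_of_one_lt (one_lt_two (α := ℝ)))
        simpa using (tendsto_const_nhds (x := dist z x * ((t : ℝ) - s))).add this
      exact le_of_tendsto_of_tendsto' ((hf x s).dist (hf x t)) h1 fun k =>
        dist_dyadicPoint_floor_le mid z x hmid k s.2.1 hst
  -- The upper bounds on [0, s], [s, t] and [t, 1] add up to `dist z x`, so the triangle inequality
  -- leaves no slack in any of them.
  have heq : ∀ x (s t : unitInterval), s ≤ t → dist (f x s) (f x t) = dist z x * ((t : ℝ) - s) :=
    fun x s t hst => by
      refine le_antisymm (hle x s t hst) ?_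
      have h1 := hle x 0 s s.2.1
      have h2 := hle x t 1 t.2.2
      rw [hf0] at h1
      rw [hf1] at h2
      have h3 := dist_triangle4 z (f x s) (f x t) x
      simp only [Set.Icc.coe_zero, Set.Icc.coe_one] at h1 h2
      linarith
  have habs : ∀ x (s t : unitInterval), dist (f x s) (f x t) = dist z x * |(s : ℝ) - t| :=
    fun x s t => by
      rcases le_total s t with h | h
      · rw [heq x s t h, abs_sub_comm, abs_of_nonneg (sub_nonneg.2 (Subtype.coe_le_coe.2 h))]
      · rw [dist_comm, heq x t s h, abs_of_nonneg (sub_nonneg.2 (Subtype.coe_le_coe.2 h))]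
  refine ⟨fun x => ⟨⟨f x, ?_⟩, hf0 x, hf1 x⟩, habs, fun t => ?_⟩
  · exact (LipschitzWith.of_dist_le_mul (K := ⟨dist z x, dist_nonneg⟩)
      fun s t => (habs x s t).le).continuous
  · exact measurable_of_tendsto_metrizable (fun k => measurable_dyadicPoint mid z hm k _)
      (tendsto_pi_nhds.2 fun x => hf x t)

/-! ### Local finiteness of the Riemannian volume -/

section Volume

open Set Metric Topology Filter

variable {E H M : Type*} [NormedAddCommGroup E] [NormedSpace ℝ E] [TopologicalSpace H]
  (I : ModelWithCorners ℝ E H)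

section

attribute [local instance] normedAddCommGroupTangentSpaceVectorSpace
attribute [local instance] normedSpaceTangentSpaceVectorSpace

/-- The inverse of an extended chart is Lipschitz for the Riemannian distance on a neighborhood of
the given point. -/
theorem exists_edist_le_mul_edist_extChartAt [PseudoEMetricSpace M]
    [ChartedSpace H M] [IsManifold I 1 M] [RiemannianBundle (fun x : M => TangentSpace I x)]
    [IsContinuousRiemannianBundle E (fun x : M => TangentSpace I x)]
    [IsRiemannianManifold I M] (x : M) :
    ∃ C : ℝ≥0, ∃ V ∈ 𝓝 x, V ⊆ (chartAt H x).source ∧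
      Bornology.IsBounded (extChartAt I x '' V) ∧ ∀ y ∈ V, ∀ y' ∈ V,
      edist y y' ≤ C * edist (extChartAt I x y) (extChartAt I x y') := by
  rcases eventually_enorm_mfderivWithin_symm_extChartAt_lt I x with ⟨C, -, hC⟩
  obtain ⟨r, r_pos, hr⟩ := mem_nhdsWithin_iff.1 (inter_mem (extChartAt_target_mem_nhdsWithin x) hC)
  have A : (extChartAt I x) ⁻¹' (ball (extChartAt I x x) r ∩ range I) ∈ 𝓝 x := by
    apply extChartAt_preimage_mem_nhds_of_mem_nhdsWithin (by simp)
    rw [inter_comm]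
    exact inter_mem_nhdsWithin _ (ball_mem_nhds _ r_pos)
  refine ⟨C, _, inter_mem A (chart_source_mem_nhds H x), inter_subset_right,
    isBounded_ball.subset (image_subset_iff.2 fun y hy => hy.1.1), ?_⟩
  rintro y ⟨hy, hys⟩ y' ⟨hy', hys'⟩
  -- Join y to y' by the image of a chart segment. The segment stays in the convex set ball ∩ `range
  -- I`, where the derivative of the inverse chart has norm at most C.
  let η := ContinuousAffineMap.lineMap (R := ℝ) (extChartAt I x y) (extChartAt I x y')
  set γ := (extChartAt I x).symm ∘ η
  have hη' : Icc 0 1 ⊆ ⇑η ⁻¹' (ball (extChartAt I x x) r ∩ range I) := by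
    simp only [← image_subset_iff, ContinuousAffineMap.coe_lineMap_eq,
     ← segment_eq_image_lineMap, η]
    exact ((convex_ball _ _).inter I.convex_range).segment_subset hy hy'
  have hη := hη'.trans (preimage_mono hr)
  rw [preimage_inter, subset_inter_iff] at hη
  have η_smooth : CMDiff[Icc 0 1] 1 η := by
    apply ContMDiff.contMDiffOn
    rw [contMDiff_iff_contDiff]
    exact ContinuousAffineMap.contDiff _
  have : riemannianEDist I y y' ≤ pathELength I γ 0 1 := by
    apply riemannianEDist_le_pathELength _ _ _ zero_le_one
    · exact (contMDiffOn_extChartAt_symm x).comp η_smooth hη.1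
    · simp [γ, η, ContinuousAffineMap.coe_lineMap_eq, hys]
    · simp [γ, η, ContinuousAffineMap.coe_lineMap_eq, hys']
  rw [IsRiemannianManifold.out (I := I)]
  apply this.trans
  rw [← lintegral_fderiv_lineMap_eq_edist, pathELength_eq_lintegral_mfderivWithin_Icc,
    ← lintegral_const_mul' _ _ ENNReal.coe_ne_top]
  apply setLIntegral_mono' measurableSet_Icc (fun t ht ↦ ?_)
  have hcomp : mfderiv[Icc 0 1] γ t =
      (mfderiv[range I] (extChartAt I x).symm (η t)) ∘L (mfderiv[Icc 0 1] η t) := by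
    apply mfderivWithin_comp
    · exact mdifferentiableWithinAt_extChartAt_symm (hη.1 ht)
    · exact η_smooth.mdifferentiableOn one_ne_zero t ht
    · exact hη.1.trans (preimage_mono (extChartAt_target_subset_range x))
    · rw [uniqueMDiffWithinAt_iff_uniqueDiffWithinAt]
      exact uniqueDiffOn_Icc zero_lt_one t ht
  have hone : mfderiv[Icc 0 1] γ t 1 =
      (mfderiv[range I] (extChartAt I x).symm (η t)) (mfderiv[Icc 0 1] η t 1) :=
    congr($hcomp 1)
  rw [hone]
  apply (ContinuousLinearMap.le_opENorm _ _).trans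
  gcongr
  · exact (hη.2 ht).le
  · simp only [mfderivWithin_eq_fderivWithin]
    exact le_of_eq rfl

end

/-- The Riemannian volume is finite on a neighborhood of every point. -/
theorem isLocallyFiniteMeasure_euclideanHausdorffMeasure {m : ℕ} [MetricSpace M]
    [ChartedSpace (EuclideanSpace ℝ (Fin m)) M] [IsManifold (𝓡 m) 1 M]
    [RiemannianBundle (fun x : M => TangentSpace (𝓡 m) x)]
    [IsContinuousRiemannianBundle (EuclideanSpace ℝ (Fin m))
      (fun x : M => TangentSpace (𝓡 m) x)]
    [IsRiemannianManifold (𝓡 m) M] [MeasurableSpace M] [BorelSpace M] :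
    IsLocallyFiniteMeasure (μHE[m] : Measure M) := by
  refine ⟨fun x => ?_⟩
  obtain ⟨C, V, hV, hVs, hb, hC⟩ := exists_edist_le_mul_edist_extChartAt (𝓡 m) x
  set φ := extChartAt (𝓡 m) x
  refine ⟨V, hV, ?_⟩
  have hinv : ∀ y ∈ V, φ.symm (φ y) = y := fun y hy =>
    φ.left_inv (by rw [extChartAt_source]; exact hVs hy)
  have hlip : LipschitzOnWith C φ.symm (φ '' V) := by
    rintro _ ⟨y, hy, rfl⟩ _ ⟨y', hy', rfl⟩
    rw [hinv y hy, hinv y' hy']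
    exact hC y hy y' hy'
  have himg : φ.symm '' (φ '' V) = V := by
    rw [image_image]
    exact (image_congr hinv).trans (image_id' V)
  have hle := hlip.hausdorffMeasure_image_le (d := m) (Nat.cast_nonneg m)
  rw [himg] at hle
  have hfin : (μH[m] : Measure (EuclideanSpace ℝ (Fin m))) (φ '' V) < ⊤ := by
    have : (μH[m] : Measure (EuclideanSpace ℝ (Fin m))).IsAddHaarMeasure := by
      simpa using MeasureTheory.isAddHaarMeasure_hausdorffMeasure (E := EuclideanSpace ℝ (Fin m))
    exact hb.measure_lt_top
  rw [Measure.euclideanHausdorffMeasure_def, Measure.smul_apply, ENNReal.smul_def, smul_eq_mul]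
  refine ENNReal.mul_lt_top ENNReal.coe_lt_top (hle.trans_lt (ENNReal.mul_lt_top ?_ hfin))
  simp

end Volume

/-! ### Local contractibility of manifolds -/

section LocallyContractible

open Set Topology Filter

theorem ChartedSpace.stronglyLocallyContractibleSpace (H M : Type*) [TopologicalSpace H]
    [TopologicalSpace M] [ChartedSpace H M] [StronglyLocallyContractibleSpace H] :
    StronglyLocallyContractibleSpace M := by
  refine StronglyLocallyContractibleSpace.of_bases
    (p := fun (x : M) (s : Set H) =>
      (s ∈ 𝓝 (chartAt H x x) ∧ ContractibleSpace s) ∧ s ⊆ (chartAt H x).target)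
    (s := fun (x : M) (s : Set H) => (chartAt H x).symm '' s) (fun x => ?_) fun x s hs => ?_
  · simpa only [OpenPartialHomeomorph.symm_map_nhds_eq, mem_chart_source] using!
      ((contractible_basis (chartAt H x x)).restrict_subset
        ((chartAt H x).open_target.mem_nhds (mem_chart_target H x))).map (chartAt H x).symm
  · have := hs.1.2
    exact ((chartAt H x).symm.homeomorphOfImageSubsetSource hs.2 rfl).symm.contractibleSpace

theorem stronglyLocallyContractibleSpace_of_normedSpace (E : Type*) [NormedAddCommGroup E]
    [NormedSpace ℝ E] : StronglyLocallyContractibleSpace E :=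
  .of_bases (fun _ => Metric.nhds_basis_ball) fun _ _ => Metric.contractibleSpace_ball

end LocallyContractible

/-! ### Homotopy classes of close paths -/

section HomotopyClasses

open Set Topology Filter Path
open scoped unitInterval

variable {X : Type*} [TopologicalSpace X]

theorem Path.homotopic_of_range_subset {V : Set X} [SimplyConnectedSpace V] {a b : X}
    (p q : Path a b) (hp : range p ⊆ V) (hq : range q ⊆ V) : p.Homotopic q := by
  have ha : a ∈ V := by simpa using hp ⟨0, rfl⟩
  have hb : b ∈ V := by simpa using hp ⟨1, rfl⟩
  let lift (r : Path a b) (hr : range r ⊆ V) : Path (⟨a, ha⟩ : V) ⟨b, hb⟩ :=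
    { toFun := fun t => ⟨r t, hr ⟨t, rfl⟩⟩
      source' := Subtype.ext r.source
      target' := Subtype.ext r.target }
  exact (SimplyConnectedSpace.paths_homotopic (lift p hp) (lift q hq)).map ⟨_, continuous_subtype_val⟩

theorem Path.homotopic_of_trans_homotopic_trans {a a₁ a₂ b b₁ b₂ : X} {p q : Path a b}
    (h₁ : a₁ = a) (h₂ : a₂ = a) (h₃ : b₁ = b) (h₄ : b₂ = b) {u : Path a₁ a₂} {v : Path b₁ b₂}
    (hu : u.Homotopic ((Path.refl a).cast h₁ h₂)) (hv : v.Homotopic ((Path.refl b).cast h₃ h₄))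
    (h : ((p.cast h₁ h₃).trans v).Homotopic (u.trans (q.cast h₂ h₄))) : p.Homotopic q := by
  subst h₁ h₃
  subst h₂ h₄
  refine (Homotopic.trans_refl p).symm.trans ?_
  refine (Homotopic.hcomp (Homotopic.refl p) hv.symm).trans ?_
  exact h.trans ((Homotopic.hcomp hu (Homotopic.refl q)).trans (Homotopic.refl_trans q))

/-- Two adjacent squares of a ladder between p and q that commute up to homotopy are glued along the
rung v. -/
theorem Path.subpath_trans_homotopic {a b : X} (p q : Path a b) {s t : I}
    {u : Path (p 0) (q 0)} {v : Path (p s) (q s)} {w : Path (p t) (q t)}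
    (h : ((p.subpath 0 s).trans v).Homotopic (u.trans (q.subpath 0 s)))
    (hst : ((p.subpath s t).trans w).Homotopic (v.trans (q.subpath s t))) :
    ((p.subpath 0 t).trans w).Homotopic (u.trans (q.subpath 0 t)) := by
  have hp : Homotopic _ _ := ⟨Homotopy.subpathTransSubpath p 0 s t⟩
  have hq : Homotopic _ _ := ⟨Homotopy.subpathTransSubpath q 0 s t⟩
  rw [← Homotopic.Quotient.eq] at h hst hp hq ⊢
  simp only [Homotopic.Quotient.mk_trans] at h hst hp hq ⊢
  rw [← hp, ← hq, Homotopic.Quotient.trans_assoc, hst, ← Homotopic.Quotient.trans_assoc, h,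
    Homotopic.Quotient.trans_assoc]

/-- In a strongly locally contractible space, close paths with the same endpoints are homotopic. -/
theorem Path.eventually_homotopic [StronglyLocallyContractibleSpace X] {a b : X} (p : Path a b) :
    ∀ᶠ q in 𝓝 p, p.Homotopic q := by
  have hV : ∀ x : X, ∃ V ∈ 𝓝 x, ContractibleSpace V := fun x => by
    obtain ⟨V, hV, -⟩ := (contractible_basis x).mem_iff.1 univ_mem
    exact ⟨V, hV⟩
  choose V hVx hVc using hV
  obtain ⟨t, ht0, htm, ⟨N, hN⟩, htV⟩ := exists_monotone_Icc_subset_open_cover_unitInterval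
    (c := fun x => p ⁻¹' interior (V x)) (fun x => isOpen_interior.preimage p.continuous)
    (fun s _ => mem_iUnion.2 ⟨p s, mem_interior_iff_mem_nhds.2 (hVx _)⟩)
  choose i hi using htV
  -- The rung at `t k` will run inside `W k`, which must lie in both adjacent contractible sets; at
  -- k = 0 there is no previous one.
  have hW : ∀ k, ∃ W, IsOpen W ∧ p (t k) ∈ W ∧ IsPathConnected W ∧ W ⊆ V (i k) ∧
      (k ≠ 0 → W ⊆ V (i (k - 1))) := fun k => by
    have h1 : interior (V (i k)) ∈ 𝓝 (p (t k)) :=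
      isOpen_interior.mem_nhds (hi k ⟨le_rfl, htm (Nat.le_succ k)⟩)
    have h2 : {x | k ≠ 0 → x ∈ interior (V (i (k - 1)))} ∈ 𝓝 (p (t k)) := by
      rcases eq_or_ne k 0 with rfl | hk
      · simp
      · simp only [hk, ne_eq, not_false_eq_true, forall_const]
        obtain ⟨j, rfl⟩ := Nat.exists_eq_succ_of_ne_zero hk
        exact isOpen_interior.mem_nhds (hi j ⟨htm (Nat.le_succ j), le_rfl⟩)
    obtain ⟨W, ⟨hWo, hpW, hWp⟩, hWs⟩ :=
      (isOpen_isPathConnected_basis (p (t k))).mem_iff.1 (inter_mem h1 h2)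
    exact ⟨W, hWo, hpW, hWp, fun x hx => interior_subset (hWs hx).1,
      fun hk x hx => interior_subset ((hWs hx).2 hk)⟩
  choose W hWo hpW hWp hWV hWV' using hW
  have hq1 : ∀ᶠ q : Path a b in 𝓝 p, ∀ k ∈ Finset.range (N + 1), q (t k) ∈ W k :=
    (Finset.eventually_all _).2 fun k _ =>
      (continuous_eval_const (t k)).continuousAt.eventually ((hWo k).mem_nhds (hpW k))
  have hq2 : ∀ᶠ q : Path a b in 𝓝 p, ∀ k ∈ Finset.range (N + 1),
      MapsTo q (Icc (t k) (t (k + 1))) (V (i k)) :=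
    (Finset.eventually_all _).2 fun k _ => by
      have hcont : ContinuousAt (fun q : Path a b => (q : C(I, X))) p :=
        continuous_induced_dom.continuousAt
      have := hcont.eventually (ContinuousMap.eventually_mapsTo isCompact_Icc isOpen_interior
        (f := (p : C(I, X))) (hi k))
      exact this.mono fun q hq s hs => interior_subset (hq hs)
  filter_upwards [hq1, hq2] with q hqW hqV
  have hw : ∀ k ≤ N, ∃ w : Path (p (t k)) (q (t k)), range w ⊆ W k := fun k hk => by
    obtain ⟨w, hw⟩ := (hWp k).joinedIn _ (hpW k) _ (hqW k (by simp; omega))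
    exact ⟨w, range_subset_iff.2 hw⟩
  obtain ⟨u, hu⟩ : ∃ u : Path (p 0) (q 0), range u ⊆ W 0 := by
    obtain ⟨u, hu⟩ := hw 0 (Nat.zero_le N)
    rw [← ht0]
    exact ⟨u, hu⟩
  -- Each square of the ladder lies in one contractible `V (i k)`, hence commutes up to homotopy.
  -- The extra variable s allows replacing `t 0` by 0 and `t N` by 1 in the types of the paths.
  have key : ∀ k ≤ N, ∀ s, s = t k → ∃ w : Path (p s) (q s), range w ⊆ W k ∧
      ((p.subpath 0 s).trans w).Homotopic (u.trans (q.subpath 0 s)) := by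
    intro k
    induction k with
    | zero =>
      rintro - s hs
      rw [ht0] at hs
      subst hs
      refine ⟨u, hu, ?_⟩
      rw [subpath_self, subpath_self]
      exact (Homotopic.refl_trans u).trans (Homotopic.trans_refl u).symm
    | succ k ih =>
      rintro hk s rfl
      obtain ⟨v, hvW, hv⟩ := ih (by omega) _ rfl
      obtain ⟨w, hwW⟩ := hw (k + 1) hk
      refine ⟨w, hwW, subpath_trans_homotopic p q hv ?_⟩
      have hle : t k ≤ t (k + 1) := htm (Nat.le_succ k)
      have := hVc (i k)
      refine homotopic_of_range_subset (V := V (i k)) _ _ ?_ ?_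
      · rw [trans_range, range_subpath_of_le _ _ _ hle]
        refine union_subset (image_subset_iff.2 fun s hs =>
          interior_subset (s := V (i k)) (hi k hs))
          (hwW.trans (hWV' (k + 1) (by omega)))
      · rw [trans_range, range_subpath_of_le _ _ _ hle]
        exact union_subset (hvW.trans (hWV k))
          (image_subset_iff.2 (hqV k (by simp; omega)))
  obtain ⟨w, hwW, H⟩ := key N le_rfl 1 (hN N le_rfl).symm
  rw [subpath_zero_one, subpath_zero_one] at H
  have h0 := hVc (i 0)
  have h1 := hVc (i N)
  refine homotopic_of_trans_homotopic_trans p.source q.source p.target q.target ?_ ?_ H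
  · refine homotopic_of_range_subset (V := V (i 0)) _ _ (hu.trans (hWV 0)) ?_
    rintro _ ⟨s, rfl⟩
    have := hWV 0 (hpW 0)
    rw [ht0] at this
    simpa using this
  · refine homotopic_of_range_subset (V := V (i N)) _ _ (hwW.trans (hWV N)) ?_
    rintro _ ⟨s, rfl⟩
    have := hWV N (hpW N)
    rw [hN N le_rfl] at this
    simpa using this

theorem Path.isLocallyConstant_homotopicQuotientMk [StronglyLocallyContractibleSpace X] (a b : X) :
    IsLocallyConstant (Homotopic.Quotient.mk : Path a b → Homotopic.Quotient a b) :=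
  (IsLocallyConstant.iff_eventually_eq _).2 fun p =>
    p.eventually_homotopic.mono fun _ hq => (Homotopic.Quotient.eq.2 hq).symm

end HomotopyClasses

/-! ### Measurability in spaces of paths -/

section PathMeasurability

open Set Topology
open scoped unitInterval

variable {X M : Type*} [MeasurableSpace X] [MetricSpace M] [SecondCountableTopology M]
  [MeasurableSpace M] [BorelSpace M]

/-- A closed sup-norm ball is cut out by evaluations at a countable dense set of times, and by
separability an open set is a countable union of such balls. -/
theorem ContinuousMap.measurableSet_preimage_of_measurable_eval {K : Type*} [TopologicalSpace K]
    [CompactSpace K] [LocallyCompactSpace K] [SecondCountableTopology K] {Θ : X → C(K, M)}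
    (h : ∀ t, Measurable fun x => Θ x t) {O : Set C(K, M)} (hO : IsOpen O) :
    MeasurableSet (Θ ⁻¹' O) := by
  have hball : ∀ (f : C(K, M)) (r : ℝ), 0 ≤ r → MeasurableSet (Θ ⁻¹' Metric.closedBall f r) := by
    intro f r hr
    obtain ⟨D, hDc, hD⟩ := TopologicalSpace.exists_countable_dense K
    have : Θ ⁻¹' Metric.closedBall f r = ⋂ t ∈ D, {x | dist (Θ x t) (f t) ≤ r} := by
      ext x
      simp only [mem_preimage, Metric.mem_closedBall, mem_iInter, mem_ofPred_eq]
      rw [ContinuousMap.dist_le hr]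
      refine ⟨fun hx t _ => hx t, fun hx => ?_⟩
      exact hD.induction hx (isClosed_le (by fun_prop) continuous_const)
    rw [this]
    exact MeasurableSet.biInter hDc fun t _ =>
      measurableSet_le ((h t).dist measurable_const) measurable_const
  obtain ⟨D, hDc, hD⟩ := TopologicalSpace.exists_countable_dense C(K, M)
  have : Θ ⁻¹' O = ⋃ f ∈ D, ⋃ n : ℕ, ⋃ _ : Metric.closedBall f (1 / ((n : ℝ) + 1)) ⊆ O,
      Θ ⁻¹' Metric.closedBall f (1 / ((n : ℝ) + 1)) := by
    refine Subset.antisymm (fun x hx => ?_) ?_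
    · obtain ⟨ε, hε, hεO⟩ := Metric.isOpen_iff.1 hO (Θ x) hx
      obtain ⟨n, hn⟩ := exists_nat_one_div_lt (half_pos hε)
      obtain ⟨f, hfD, hf⟩ := hD.exists_dist_lt (Θ x) (Nat.one_div_pos_of_nat (α := ℝ) (n := n))
      simp only [mem_iUnion, exists_prop]
      refine ⟨f, hfD, n, fun g hg => hεO ?_, hf.le⟩
      have := dist_triangle g f (Θ x)
      rw [dist_comm f] at this
      rw [Metric.mem_closedBall] at hg
      rw [Metric.mem_ball]
      linarith
    · simp only [iUnion_subset_iff]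
      exact fun f _ n hn => preimage_mono hn
  rw [this]
  exact MeasurableSet.biUnion hDc fun f _ => MeasurableSet.iUnion fun n =>
    MeasurableSet.iUnion fun _ => hball f _ (by positivity)

/-- A continuous function of finitely many Borel families of paths is Borel measurable. -/
theorem Path.measurable_comp_of_measurable_eval {ι Z : Type*} [Finite ι] [TopologicalSpace Z]
    [MeasurableSpace Z] [BorelSpace Z] {a b : M} {F : (ι → Path a b) → Z} (hF : Continuous F)
    {Θ : ι → X → Path a b} (h : ∀ i t, Measurable fun x => Θ i x t) :
    Measurable fun x => F fun i => Θ i x := by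
  -- Second countability makes open sets of the finite product measurable for the product σ-algebra,
  -- so each factor can be treated separately.
  let _ : MeasurableSpace (Path a b) := borel _
  have : BorelSpace (Path a b) := ⟨rfl⟩
  have : SecondCountableTopology (Path a b) :=
    (IsInducing.mk rfl : IsInducing ((↑) : Path a b → C(I, M))).secondCountableTopology
  refine hF.measurable.comp (measurable_pi_lambda _ fun i => measurable_of_isOpen ?_)
  rintro _ ⟨O, hO, rfl⟩
  exact ContinuousMap.measurableSet_preimage_of_measurable_eval
    (Θ := fun x => (Θ i x : C(I, M))) (h i) hO

end PathMeasurability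

/-! ### Loop classes modulo the center -/

section IsotopyTraces

open Path
open scoped unitInterval

variable {M : Type*} [TopologicalSpace M]

theorem Isotopy.map_trans_trace {g : M ≃ₜ M} (H : Isotopy g) {x y : M} (p : Path x y) :
    (p.trans (H.trace y)).Homotopic ((H.trace x).trans (p.map g.continuous)) := by
  let F : (ContinuousMap.id M).Homotopy ⟨g, g.continuous⟩ :=
    { toFun := fun p => H.map p.1 p.2
      continuous_toFun := H.continuous_map
      map_zero_left := fun x => by simp [H.map_zero]
      map_one_left := fun x => by simp [H.map_one] }
  exact Path.Homotopic.map_trans_evalAt F p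

/-- In the square (s, t) ↦ H_s(K_t(x)) the diagonal is homotopic to the path along two edges, on
which K moves first. -/
theorem Isotopy.trace_mul_homotopic {g h : M ≃ₜ M} (H : Isotopy g) (K : Isotopy h) (x : M) :
    ((H.mul K).trace x).Homotopic ((K.trace x).trans (H.trace (h x))) := by
  let G : C(I × I, M) := ⟨fun p => H.map p.1 (K.map p.2 x), H.continuous_map.comp
    (continuous_fst.prodMk (K.continuous_map.comp (continuous_snd.prodMk continuous_const)))⟩
  let p₁ : Path ((0, 0) : I × I) (1, 1) := .prod .id .id
  let p₂ : Path ((0, 0) : I × I) (1, 1) := .prod (.trans (.refl _) .id) (.trans .id (.refl _))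
  let Fsq : p₁.Homotopy p₂ := Path.Homotopic.prodHomotopy
    (Path.Homotopy.reflTrans _).symm (Path.Homotopy.transRefl _).symm
  refine ⟨((Fsq.map G).pathCast ?_ ?_).cast ?_ ?_⟩
  · simp [G, H.map_zero, K.map_zero]
  · simp [G, H.map_one, K.map_one]
  · ext t
    rfl
  · ext t
    symm
    change ((K.trace x).trans (H.trace (h x))) t =
      H.map (((Path.refl 0).trans .id) t) (K.map ((Path.trans .id (.refl 1)) t) x)
    rw [Path.trans_apply, Path.trans_apply, Path.trans_apply]
    split_ifs
    · simp only [Path.refl_apply, H.map_zero]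
      rfl
    · simp only [Path.refl_apply, K.map_one]
      rfl

/-- The conjugation of an isotopy by a homeomorphism. -/
def Isotopy.conj {h : M ≃ₜ M} (H : Isotopy h) (f : M ≃ₜ M) : Isotopy (f⁻¹ * h * f) where
  map t := f⁻¹ * H.map t * f
  map_zero := by rw [H.map_zero]; group
  map_one := by rw [H.map_one]
  continuous_map := f.symm.continuous.comp
    (H.continuous_map.comp (continuous_fst.prodMk (f.continuous.comp continuous_snd)))
  continuous_symm := f.symm.continuous.comp
    (H.continuous_symm.comp (continuous_fst.prodMk (f.continuous.comp continuous_snd)))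

variable {z : M} (δ : ∀ x : M, Path z x)

theorem mk_isotopyLoop {g : M ≃ₜ M} (H : Isotopy g) (x : M) :
    Homotopic.Quotient.mk (isotopyLoop δ H x) =
      ((Homotopic.Quotient.mk (δ x)).trans (Homotopic.Quotient.mk (H.trace x))).trans
        (Homotopic.Quotient.mk (δ (g x))).symm := rfl

theorem Path.Homotopic.Quotient.symm_trans_trans {a b c : M} (p : Homotopic.Quotient a b)
    (q : Homotopic.Quotient b c) : p.symm.trans (p.trans q) = q := by
  rw [← Homotopic.Quotient.trans_assoc, Homotopic.Quotient.symm_trans,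
    Homotopic.Quotient.refl_trans]

theorem Path.Homotopic.Quotient.trans_symm_trans {a b c : M} (p : Homotopic.Quotient a b)
    (q : Homotopic.Quotient a c) : p.trans (p.symm.trans q) = q := by
  rw [← Homotopic.Quotient.trans_assoc, Homotopic.Quotient.trans_symm,
    Homotopic.Quotient.refl_trans]

/-- Carry α to a loop β at x. Every isotopy slides β to g∘β, so ε, the class of g∘β carried back to
z, serves all isotopies at once. Thus any two of their loops conjugate α to the same element and
differ by a central one. -/
theorem exists_isotopyLoop_mul (g : M ≃ₜ M) (x : M) (α : FundamentalGroup M z) :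
    ∃ ε : FundamentalGroup M z, ∀ H : Isotopy g,
      FundamentalGroup.fromPath (Homotopic.Quotient.mk (isotopyLoop δ H x)) * α =
        ε * FundamentalGroup.fromPath (Homotopic.Quotient.mk (isotopyLoop δ H x)) := by
  obtain ⟨a, rfl⟩ := Homotopic.Quotient.mk_surjective α
  let β : Path x x := (δ x).symm.trans (a.trans (δ x))
  refine ⟨FundamentalGroup.fromPath (Homotopic.Quotient.mk
    ((δ (g x)).trans ((β.map g.continuous).trans (δ (g x)).symm))), fun H => ?_⟩
  have h := Homotopic.Quotient.eq.2 (H.map_trans_trace β)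
  simp only [FundamentalGroup.mul_def, FundamentalGroup.fromPath, mk_isotopyLoop,
    Homotopic.Quotient.mk_trans, Homotopic.Quotient.mk_symm, Homotopic.Quotient.trans_assoc,
    Homotopic.Quotient.symm_trans_trans, β] at h ⊢
  rw [← Homotopic.Quotient.trans_assoc (Homotopic.Quotient.mk (H.trace x)), ← h]
  simp only [Homotopic.Quotient.trans_assoc, Homotopic.Quotient.trans_symm_trans]

theorem mul_inv_mul_eq_of_mul_eq {G : Type*} [Group G] {u v a e : G} (hu : u * a = e * u)
    (hv : v * a = e * v) : a * (u⁻¹ * v) = u⁻¹ * v * a := by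
  obtain rfl : e = u * a * u⁻¹ := eq_mul_inv_of_mul_eq hu.symm
  rw [mul_assoc, hv]
  group

theorem inv_mul_isotopyLoop_mem_center {g : M ≃ₜ M} (H K : Isotopy g) (x : M) :
    (FundamentalGroup.fromPath (Homotopic.Quotient.mk (isotopyLoop δ H x)))⁻¹ *
      FundamentalGroup.fromPath (Homotopic.Quotient.mk (isotopyLoop δ K x)) ∈
      Subgroup.center (FundamentalGroup M z) := by
  rw [Subgroup.mem_center_iff]
  intro α
  obtain ⟨ε, hε⟩ := exists_isotopyLoop_mul δ g x α
  exact mul_inv_mul_eq_of_mul_eq (hε H) (hε K)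

/-- Modulo the center of the fundamental group, the class of the loop of an isotopy only depends on
the end of the isotopy. -/
theorem gammaBM_eq {g : M ≃ₜ M} (H : Isotopy g) (x : M) :
    gammaBM δ g x = QuotientGroup.mk (FundamentalGroup.fromPath
      (Homotopic.Quotient.mk (isotopyLoop δ H x))) := by
  rw [gammaBM, dif_pos ⟨H⟩]
  exact QuotientGroup.eq.2 (inv_mul_isotopyLoop_mem_center δ _ H x)

theorem gammaBM_mul {g h : M ≃ₜ M} (H : Isotopy g) (K : Isotopy h) (x : M) :
    gammaBM δ (g * h) x = gammaBM δ g (h x) * gammaBM δ h x := by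
  rw [gammaBM_eq δ (H.mul K), gammaBM_eq δ H, gammaBM_eq δ K, ← QuotientGroup.mk_mul,
    FundamentalGroup.mul_def]
  congr 1
  have h : Homotopic.Quotient.mk ((H.mul K).trace x) =
      (Homotopic.Quotient.mk (K.trace x)).trans (Homotopic.Quotient.mk (H.trace (h x))) :=
    Homotopic.Quotient.eq.2 (H.trace_mul_homotopic K x)
  simp only [FundamentalGroup.fromPath, mk_isotopyLoop, Homotopic.Quotient.trans_assoc,
    Homotopic.Quotient.symm_trans_trans]
  rw [h]
  exact congrArg (Homotopic.Quotient.mk (δ x)).trans (Homotopic.Quotient.trans_assoc _ _ _)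

theorem gammaBM_eq_one {g : M ≃ₜ M} (H : Isotopy g) {x : M} (hx : ∀ t, H.map t x = x) :
    gammaBM δ g x = 1 := by
  rw [gammaBM_eq δ H]
  -- The endpoint is generalized because `g x` equals `x` only propositionally.
  have key : ∀ (y : M) (τ : Path x y), (∀ t, τ t = x) →
      Homotopic.Quotient.mk (((δ x).trans τ).trans (δ y).symm) = Homotopic.Quotient.refl z := by
    intro y τ hτ
    obtain rfl : x = y := by rw [← hτ 1, τ.target]
    have : τ = Path.refl x := by
      ext t
      exact hτ t
    subst this
    simp [Homotopic.Quotient.mk_trans, Homotopic.Quotient.mk_symm, Homotopic.Quotient.mk_refl]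
  rw [isotopyLoop, key _ (H.trace x) hx]
  rfl

end IsotopyTraces

/-! ### The integrand, its support and the estimate -/

theorem alternatingCochains_eq_zero {G : Type*} [Group G] {n : ℕ} {c : (Fin (n + 1) → G) → ℝ}
    (hc : c ∈ alternatingCochains G n) {i j : Fin (n + 1)} (hij : i ≠ j) {v : Fin (n + 1) → G}
    (hv : v i = v j) : c v = 0 := by
  have h := hc.2 v (Equiv.swap i j)
  have hvs : (fun k => v (Equiv.swap i j k)) = v := by
    ext k
    rcases eq_or_ne k i with rfl | hi
    · rw [Equiv.swap_apply_left, hv]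
    · rcases eq_or_ne k j with rfl | hj
      · rw [Equiv.swap_apply_right, hv]
      · rw [Equiv.swap_apply_of_ne_of_ne hi hj]
  rw [hvs, Equiv.Perm.sign_swap hij] at h
  push_cast at h
  linarith

section Integrand

open Path Set

variable {M : Type*}

theorem exists_isotopy_of_mem [TopologicalSpace M] [MeasurableSpace M] [BorelSpace M]
    {μ : Measure M} {T : Subgroup (M ≃ₜ M)} (hT : T ≤ homeoZero μ) (g : T) :
    Nonempty (Isotopy (g : M ≃ₜ M)) :=
  let ⟨_, H, _⟩ := hT g.2
  ⟨H⟩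

theorem gammaBM_eq_of_fixed [TopologicalSpace M] [MeasurableSpace M] [BorelSpace M] {z : M}
    (δ : ∀ x : M, Path z x) {μ : Measure M} {T : Subgroup (M ≃ₜ M)} (hT : T ≤ homeoZero μ)
    {g h : T} {x : M} (hx : ((g⁻¹ * h : T) : M ≃ₜ M) x = x)
    (hγ : gammaBM δ ((g⁻¹ * h : T) : M ≃ₜ M) x = 1) :
    gammaBM δ (g : M ≃ₜ M) x = gammaBM δ (h : M ≃ₜ M) x := by
  obtain ⟨H⟩ := exists_isotopy_of_mem hT g
  obtain ⟨K⟩ := exists_isotopy_of_mem hT (g⁻¹ * h)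
  have := gammaBM_mul δ H K x
  rw [hx, hγ, mul_one] at this
  rw [← this, ← Subgroup.coe_mul, mul_inv_cancel_left]

theorem integrandBM_eq_zero [TopologicalSpace M] [MeasurableSpace M] [BorelSpace M] {z : M}
    (δ : ∀ x : M, Path z x) {μ : Measure M} {T : Subgroup (M ≃ₜ M)} (hT : T ≤ homeoZero μ)
    {n : ℕ} {c : (Fin (n + 1) → CentralQuotient z) → ℝ}
    (hc : c ∈ alternatingCochains (CentralQuotient z) n) (g : Fin (n + 1) → T)
    {i j : Fin (n + 1)} (hij : i ≠ j) {x : M} (hx : (((g i)⁻¹ * g j : T) : M ≃ₜ M) x = x)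
    (hγ : gammaBM δ (((g i)⁻¹ * g j : T) : M ≃ₜ M) x = 1) : integrandBM δ c g x = 0 :=
  alternatingCochains_eq_zero hc hij (gammaBM_eq_of_fixed δ hT hx hγ)

theorem measurable_isotopyLoop [TopologicalSpace M] [MeasurableSpace M] [BorelSpace M] {z : M}
    {δ : ∀ x : M, Path z x} (hδ : ∀ t : unitInterval, Measurable fun x => δ x t) {g : M ≃ₜ M}
    (H : Isotopy g) (t : unitInterval) : Measurable fun x => isotopyLoop δ H x t := by
  simp only [isotopyLoop, Path.trans_apply, Path.symm_apply]
  split_ifs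
  · exact hδ _
  · exact (H.map _).continuous.measurable
  · exact (hδ _).comp g.continuous.measurable

theorem measurable_integrandBM [MetricSpace M] [SecondCountableTopology M]
    [StronglyLocallyContractibleSpace M] [MeasurableSpace M] [BorelSpace M] {z : M}
    {δ : ∀ x : M, Path z x} (hδ : ∀ t : unitInterval, Measurable fun x => δ x t) {μ : Measure M}
    {T : Subgroup (M ≃ₜ M)} (hT : T ≤ homeoZero μ) {n : ℕ}
    (c : (Fin (n + 1) → CentralQuotient z) → ℝ) (g : Fin (n + 1) → T) :
    Measurable (integrandBM δ c g) := by
  let H : ∀ i, Isotopy (g i : M ≃ₜ M) := fun i => (exists_isotopy_of_mem hT (g i)).some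
  let F : (Fin (n + 1) → Path z z) → ℝ := fun p => c fun i =>
    QuotientGroup.mk (FundamentalGroup.fromPath (Homotopic.Quotient.mk (p i)))
  have hF : Continuous F := by
    refine ((IsLocallyConstant.iff_eventually_eq _).2 fun p => ?_).continuous
    have : ∀ i, ∀ᶠ q : Fin (n + 1) → Path z z in nhds p,
        Homotopic.Quotient.mk (q i) = Homotopic.Quotient.mk (p i) := fun i =>
      (continuous_apply i).continuousAt.eventually ((IsLocallyConstant.iff_eventually_eq _).1
        (Path.isLocallyConstant_homotopicQuotientMk z z) (p i))
    filter_upwards [Filter.eventually_all.2 this] with q hq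
    simp only [F, hq]
  have heq : integrandBM δ c g = fun x => F fun i => isotopyLoop δ (H i) x := by
    funext x
    exact congrArg c (funext fun i => gammaBM_eq δ (H i) x)
  rw [heq]
  exact Path.measurable_comp_of_measurable_eval hF fun i t => measurable_isotopyLoop hδ (H i) t

/-- By the cocycle rule, translating by h replaces x by h(x) and multiplies all arguments of c on
the right by γ(h, x). Homogeneity of c removes the factor and invariance of μ the substitution. -/
theorem phiBM_mem_alternatingCochains [TopologicalSpace M] [MeasurableSpace M] [BorelSpace M]
    {z : M} (δ : ∀ x : M, Path z x) {μ : Measure M} {T : Subgroup (M ≃ₜ M)}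
    (hT : T ≤ homeoZero μ) {n : ℕ} {c : (Fin (n + 1) → CentralQuotient z) → ℝ}
    (hc : c ∈ alternatingCochains (CentralQuotient z) n) :
    phiBM μ δ T c ∈ alternatingCochains T n := by
  refine ⟨fun g h => ?_, fun g σ => ?_⟩
  · obtain ⟨K⟩ := exists_isotopy_of_mem hT h
    have heq : integrandBM δ c (fun i => g i * h) =
        fun x => integrandBM δ c g ((h : M ≃ₜ M).toMeasurableEquiv x) := by
      ext x
      have : ∀ i, gammaBM δ ((g i * h : T) : M ≃ₜ M) x =
          gammaBM δ (g i : M ≃ₜ M) ((h : M ≃ₜ M) x) * gammaBM δ (h : M ≃ₜ M) x := fun i => by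
        obtain ⟨H⟩ := exists_isotopy_of_mem hT (g i)
        exact gammaBM_mul δ H K x
      simp only [integrandBM, this]
      exact hc.1 _ _
    have hmp : MeasurePreserving (h : M ≃ₜ M).toMeasurableEquiv μ μ := (hT h.2).1
    rw [phiBM, heq]
    exact hmp.integral_comp' (integrandBM δ c g)
  · rw [phiBM, phiBM, ← integral_const_mul]
    exact integral_congr_ae (Filter.Eventually.of_forall fun x =>
      hc.2 (fun i => gammaBM δ (g i : M ≃ₜ M) x) σ)

theorem exists_measure_le_of_mem_conjugatedFragments [TopologicalSpace M] [MeasurableSpace M]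
    [BorelSpace M] {z : M} (δ : ∀ x : M, Path z x) {μ : Measure M} {T : Subgroup (M ≃ₜ M)}
    (hT : T ≤ homeoZero μ) {U : Set M} (hU : IsOpen U) {k : T}
    (hk : k ∈ conjugatedFragments T U) :
    ∃ B, MeasurableSet B ∧ μ B ≤ μ U ∧
      ∀ x ∉ B, (k : M ≃ₜ M) x = x ∧ gammaBM δ (k : M ≃ₜ M) x = 1 := by
  obtain ⟨f, h, ⟨H, hH⟩, rfl⟩ := hk
  refine ⟨(f : M ≃ₜ M) ⁻¹' U, (hU.preimage (f : M ≃ₜ M).continuous).measurableSet,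
    ((hT f.2).1.measure_preimage hU.measurableSet.nullMeasurableSet).le, fun x hx => ?_⟩
  have hfix : ∀ t, (H.conj (f : M ≃ₜ M)).map t x = x := fun t => by
    have : H.map t ((f : M ≃ₜ M) x) = (f : M ≃ₜ M) x := by
      by_contra hcon
      exact hx (hH t (subset_closure hcon))
    change (f : M ≃ₜ M).symm (H.map t ((f : M ≃ₜ M) x)) = x
    rw [this, Homeomorph.symm_apply_apply]
  refine ⟨?_, gammaBM_eq_one δ (H.conj (f : M ≃ₜ M)) hfix⟩
  have := hfix 1
  rwa [(H.conj (f : M ≃ₜ M)).map_one] at this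

/-- Outside the union of the exceptional sets the tail of the product fixes x, so the cocycle rule
evaluates the head at x itself. -/
theorem exists_measure_le_of_list_prod [TopologicalSpace M] [MeasurableSpace M] [BorelSpace M]
    {z : M} (δ : ∀ x : M, Path z x) {μ : Measure M} {T : Subgroup (M ≃ₜ M)}
    (hT : T ≤ homeoZero μ) {U : Set M} (hU : IsOpen U) (l : List T)
    (hl : ∀ k ∈ l, k ∈ conjugatedFragments T U) :
    ∃ B, MeasurableSet B ∧ μ B ≤ l.length * μ U ∧
      ∀ x ∉ B, ((l.prod : T) : M ≃ₜ M) x = x ∧ gammaBM δ ((l.prod : T) : M ≃ₜ M) x = 1 := by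
  induction l with
  | nil => exact ⟨∅, MeasurableSet.empty, by simp, fun x _ =>
      ⟨rfl, gammaBM_eq_one δ Isotopy.refl fun _ => rfl⟩⟩
  | cons k l ih =>
    obtain ⟨B, hB, hBμ, hBx⟩ := ih fun k' hk' => hl k' (List.mem_cons_of_mem _ hk')
    obtain ⟨B', hB', hBμ', hBx'⟩ :=
      exists_measure_le_of_mem_conjugatedFragments δ hT hU (hl k List.mem_cons_self)
    refine ⟨B ∪ B', hB.union hB', (measure_union_le B B').trans ?_, fun x hx => ?_⟩
    · rw [List.length_cons, Nat.cast_succ, add_mul, one_mul]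
      exact add_le_add hBμ hBμ'
    · rw [mem_union, not_or] at hx
      obtain ⟨h1, h2⟩ := hBx x hx.1
      obtain ⟨h3, h4⟩ := hBx' x hx.2
      obtain ⟨H⟩ := exists_isotopy_of_mem hT k
      obtain ⟨K⟩ := exists_isotopy_of_mem hT l.prod
      rw [List.prod_cons, Subgroup.coe_mul, gammaBM_mul δ H K, h2, h1, h4, Homeomorph.mul_apply, h1]
      exact ⟨h3, one_mul 1⟩

theorem ofReal_abs_phiBM_le [TopologicalSpace M] [MeasurableSpace M] [BorelSpace M] {z : M}
    (δ : ∀ x : M, Path z x) {μ : Measure M} {T : Subgroup (M ≃ₜ M)} (hT : T ≤ homeoZero μ)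
    {U : Set M} (hU : IsOpen U) (hUμ : μ U < ⊤) {n : ℕ}
    {c : (Fin (n + 1) → CentralQuotient z) → ℝ}
    (hc : c ∈ alternatingCochains (CentralQuotient z) n) {B : ℝ≥0} (hB : ∀ v, |c v| ≤ B)
    (g : Fin (n + 1) → T) {i j : Fin (n + 1)} (hij : i ≠ j) :
    ENNReal.ofReal |phiBM μ δ T c g| ≤ ((B * (μ U).toNNReal + 1 : ℝ≥0) : ℝ≥0∞) *
      (fragmentationNorm T U ((g i)⁻¹ * g j) : ℝ≥0∞) := by
  rcases eq_top_or_lt_top (fragmentationNorm T U ((g i)⁻¹ * g j)) with htop | hfin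
  -- The summand 1 keeps the constant nonzero: otherwise 0 · ∞ = 0 would spoil the bound when `B` or
  -- `μ U` vanishes.
  · rw [htop, ENat.toENNReal_top, ENNReal.mul_top (by simp)]
    exact le_top
  obtain ⟨l, hl, hprod, hlen⟩ := exists_list_of_fragmentationNorm_lt_top hfin
  obtain ⟨A, hA, hAμ, hAx⟩ := exists_measure_le_of_list_prod δ hT hU l hl
  rw [hprod] at hAx
  have hA_fin : μ A < ⊤ := hAμ.trans_lt (ENNReal.mul_lt_top (by simp) hUμ)
  have hint : phiBM μ δ T c g = ∫ x in A, integrandBM δ c g x ∂μ :=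
    (setIntegral_eq_integral_of_forall_compl_eq_zero fun x hx =>
      integrandBM_eq_zero δ hT hc g hij (hAx x hx).1 (hAx x hx).2).symm
  have hle : |phiBM μ δ T c g| ≤ B * μ.real A := by
    rw [hint]
    exact norm_setIntegral_le_of_norm_le_const (f := integrandBM δ c g) hA_fin fun x _ => hB _
  rw [hlen]
  calc ENNReal.ofReal |phiBM μ δ T c g| ≤ ENNReal.ofReal (B * μ.real A) :=
        ENNReal.ofReal_le_ofReal hle
    _ = B * μ A := by
        rw [ENNReal.ofReal_mul (NNReal.coe_nonneg B), ENNReal.ofReal_coe_nnreal, Measure.real,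
          ENNReal.ofReal_toReal hA_fin.ne]
    _ ≤ B * (l.length * μ U) := by gcongr
    _ = (B * μ U) * l.length := by ring
    _ ≤ _ := by
        push_cast
        rw [ENNReal.coe_toNNReal hUμ.ne]
        gcongr
        exact le_self_add

/-- As n ≥ 1, the indices 0 and n differ, so the integrand vanishes outside the compact support of
an isotopy of g₀⁻¹gₙ. -/
theorem integrable_integrandBM [MetricSpace M] [SecondCountableTopology M]
    [StronglyLocallyContractibleSpace M] [MeasurableSpace M] [BorelSpace M] {z : M}
    {δ : ∀ x : M, Path z x} (hδ : ∀ t : unitInterval, Measurable fun x => δ x t) {μ : Measure M}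
    [IsLocallyFiniteMeasure μ] {T : Subgroup (M ≃ₜ M)} (hT : T ≤ homeoZero μ) {n : ℕ} (hn : 1 ≤ n)
    {c : (Fin (n + 1) → CentralQuotient z) → ℝ}
    (hc : c ∈ boundedAlternatingCochains (CentralQuotient z) n) (g : Fin (n + 1) → T) :
    Integrable (integrandBM δ c g) μ := by
  obtain ⟨hca, B, hB⟩ := hc
  obtain ⟨-, H, K, hK, hH⟩ := hT ((g 0)⁻¹ * g (Fin.last n)).2
  have h0n : (0 : Fin (n + 1)) ≠ Fin.last n := by
    rw [ne_eq, Fin.ext_iff, Fin.val_zero, Fin.val_last]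
    omega
  have hsupp : Function.support (integrandBM δ c g) ⊆ K := fun x hx => by
    by_contra hxK
    refine hx (integrandBM_eq_zero δ hT hca g h0n ?_ (gammaBM_eq_one δ H fun t => hH t x hxK))
    have := hH 1 x hxK
    rwa [H.map_one] at this
  rw [← integrableOn_iff_integrable_of_support_subset hsupp]
  exact Measure.integrableOn_of_bounded hK.measure_lt_top.ne
    (measurable_integrandBM hδ hT c g).aestronglyMeasurable
    (Filter.Eventually.of_forall fun x => hB _)

end Integrand

/-- At level n - 1 the sets I are singletons, so the minimum runs over consecutive pairs. -/
theorem mem_normControlledCochains_of_forall_le {G : Type*} [Group G] {n : ℕ} (hn : 1 ≤ n)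
    {ν : GroupSeminorm G} {c : (Fin (n + 1) → G) → ℝ} (hc : c ∈ homogeneousCochains G n) {C : ℝ}
    (hC : 0 ≤ C)
    (h : ∀ (g : Fin (n + 1) → G) (i : Fin n), |c g| ≤ C * ν ((g i.castSucc)⁻¹ * g i.succ)) :
    c ∈ normControlledCochains n (n - 1) ν := by
  refine ⟨hc, C, 0, hC, le_rfl, fun g => ?_⟩
  have hcard : n - (n - 1) = 1 := by omega
  rw [add_zero, levelMin, Real.mul_iInf_of_nonneg hC]
  have : Nonempty {I : Finset (Fin n) // I.card = n - (n - 1)} :=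
    ⟨⟨{⟨0, by omega⟩}, by rw [Finset.card_singleton, hcard]⟩⟩
  refine le_ciInf ?_
  rintro ⟨I, hI⟩
  obtain ⟨i, rfl⟩ := Finset.card_eq_one.1 (hI.trans hcard)
  rw [Finset.sum_singleton]
  exact h g i

theorem proposition4p3 {m : ℕ} {M : Type*} [MetricSpace M]
    [ChartedSpace (EuclideanSpace ℝ (Fin m)) M] [IsManifold (𝓡 m) ∞ M]
    [RiemannianBundle (fun x : M => TangentSpace (𝓡 m) x)]
    [IsContMDiffRiemannianBundle (𝓡 m) ∞ (EuclideanSpace ℝ (Fin m))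
      (fun x : M => TangentSpace (𝓡 m) x)]
    [IsRiemannianManifold (𝓡 m) M] [CompleteSpace M] [ConnectedSpace M]
    [MeasurableSpace M] [BorelSpace M]
    (ρ : M → ℝ) (hρ : Continuous ρ) (hρpos : ∀ x, 0 < ρ x)
    (μ : Measure M) (hμ : μ = (μHE[m] : Measure M).withDensity fun x => ENNReal.ofReal (ρ x))
    (z : M) (T : Subgroup (M ≃ₜ M)) (hT : T ≤ homeoZero μ)
    (U : Set M) (hU : IsOpen U) (hUvol : μ U < ⊤)
    (n : ℕ) (hn : 1 ≤ n)
    (c : (Fin (n + 1) → CentralQuotient z) → ℝ)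
    (hc : c ∈ boundedAlternatingCochains (CentralQuotient z) n) :
    (∃ δ : ∀ x : M, Path z x, IsGeodesicFamily z δ) ∧
    ∀ δ : ∀ x : M, Path z x, IsGeodesicFamily z δ →
      (∀ g : Fin (n + 1) → T, Integrable (integrandBM δ c g) μ) ∧
      (∃ C : ℝ≥0, ∀ g : Fin (n + 1) → T,
        ENNReal.ofReal |phiBM μ δ T c g| ≤
          C * ⨅ (i : Fin (n + 1)) (j : Fin (n + 1)) (_ : i < j),
            (fragmentationNorm T U ((g i)⁻¹ * g j) : ℝ≥0∞)) ∧
      ∀ hfin : FragmentationNormFinite T U,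
        phiBM μ δ T c ∈
          normControlledAlternatingCochains n (n - 1) (fragmentationSeminorm T U hfin) := by
  have : IsManifold (𝓡 m) 1 M := .of_le (n := ∞) (by simp)
  have : IsContinuousRiemannianBundle (EuclideanSpace ℝ (Fin m))
      (fun x : M => TangentSpace (𝓡 m) x) := by
    obtain ⟨b, hb, hb'⟩ := IsContMDiffRiemannianBundle.exists_contMDiff (IB := 𝓡 m) (n := ∞)
      (F := EuclideanSpace ℝ (Fin m)) (E := fun x : M => TangentSpace (𝓡 m) x)
    exact ⟨b, hb.continuous, hb'⟩
  have : LocallyCompactSpace M :=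
    ChartedSpace.locallyCompactSpace (EuclideanSpace ℝ (Fin m)) M
  have hlen : IsLengthMetric M := isLengthMetric_of_isRiemannianManifold (𝓡 m)
  have : ProperSpace M := hlen.properSpace
  have := stronglyLocallyContractibleSpace_of_normedSpace (EuclideanSpace ℝ (Fin m))
  have := ChartedSpace.stronglyLocallyContractibleSpace (EuclideanSpace ℝ (Fin m)) M
  have : IsLocallyFiniteMeasure (μHE[m] : Measure M) :=
    isLocallyFiniteMeasure_euclideanHausdorffMeasure
  have : IsLocallyFiniteMeasure μ := hμ ▸ .withDensity_ofReal hρ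
  refine ⟨?_, fun δ hδ => ⟨integrable_integrandBM hδ.measurable hT hn hc, ?_⟩⟩
  · obtain ⟨δ, hδ, hδm⟩ := hlen.exists_measurable_minimizingGeodesic z
    exact ⟨δ, fun x _ => hδ x, hδm⟩
  obtain ⟨hca, B, hB⟩ := hc
  have hB' : ∀ v, |c v| ≤ (B.toNNReal : ℝ) := fun v => (hB v).trans (Real.le_coe_toNNReal B)
  have hle := fun g (i j : Fin (n + 1)) (hij : i ≠ j) =>
    ofReal_abs_phiBM_le δ hT hU hUvol hca hB' g hij
  set C := B.toNNReal * (μ U).toNNReal + 1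
  refine ⟨⟨C, fun g => ?_⟩, fun hfin => ?_⟩
  · have hC : (C : ℝ≥0∞) ≠ 0 := by simp [C]
    rw [mul_comm, ← ENNReal.div_le_iff hC ENNReal.coe_ne_top]
    refine le_iInf fun i => le_iInf fun j => le_iInf fun hij => ?_
    rw [ENNReal.div_le_iff hC ENNReal.coe_ne_top, mul_comm]
    exact hle g i j hij.ne
  · have halt := phiBM_mem_alternatingCochains δ hT hca
    refine ⟨mem_normControlledCochains_of_forall_le hn halt.1 C.2 fun g i => ?_, halt⟩
    have h := hle g i.castSucc i.succ (Fin.castSucc_lt_succ).ne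
    obtain ⟨k, hk⟩ := ENat.ne_top_iff_exists.1 (hfin ((g i.castSucc)⁻¹ * g i.succ)).ne
    change _ ≤ (C : ℝ) * ((fragmentationNorm T U ((g i.castSucc)⁻¹ * g i.succ)).toNat : ℝ)
    rw [← hk] at h ⊢
    rw [ENat.toNat_natCast]
    refine (ENNReal.ofReal_le_ofReal_iff (by positivity)).1 (h.trans_eq ?_)
    rw [ENNReal.ofReal_mul (NNReal.coe_nonneg C), ENNReal.ofReal_coe_nnreal, ENNReal.ofReal_natCast,
      ENat.toENNReal_coe]
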